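/- Let $\mathcal X$ be a finite field with $q$ elements and let $W$ be a discrete memoryless channel with input alphabet $\mathcal X$ and an at most countable output alphabet $\mathcal Y$, i.e. a conditional probability distribution $W(y\mid x)$. Its symmetric capacity is $$I(W)=\sum_{x\in\mathcal X}\sum_{y\in\mathcal Y}\frac1q W(y\mid x)\log_q\frac{W(y\mid x)}{\frac1q\sum_{x'\in\mathcal X}W(y\mid x')}.$$ Let $g:\mathcal X^\ell\to\mathcal X^\ell$ be a linear bijection (a linear kernel), $g(u)=uA$ for row vectors $u=(u_0,\dots,u_{\ell-1})$. For $0\le i\le \ell-1$ let $W^{(i)}$ be the channel with input $u_i\in\mathcal X$, output $(y_0^{\ell-1},u_0^{i-1})\in\mathcal Y^\ell\times\mathcal X^i$ and transition probabilities $$W^{(i)}(y_0^{\ell-1},u_0^{i-1}\mid u_i)=\frac1{q^{\ell-1}}\sum_{u_{i+1}^{\ell-1}}\ \prod_{j=0}^{\ell-1}W\big(y_j\mid g(u_0^{\ell-1})_j\big).$$ Let $G=VAP$ be a normal form of the kernel, where $V$ is an invertible upper triangular matrix, $P$ is a permutation matrix (the case $V=P=1$ is allowed), $G$ is lower triangular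 and not diagonal, and $G_{kk}=1$, where $k\in\{0,\dots,\ell-1\}$ is the largest index such that the $k$-th row of $G$ has more than one non-zero entry. Suppose that for some $j\in\{0,\dots,k-1\}$ the entry $G_{kj}$ is a primitive element of $\mathcal X$, i.e. a generator of the multiplicative group $\mathcal X\setminus\{0\}$. Let $B_0,B_1,\dots$ be independent random variables, each uniformly distributed on $\{0,\dots,\ell-1\}$. Then there is a random variable $I_\infty$ such that $I\big(W^{(B_0)(B_1)\cdots(B_n)}\big)\to I_\infty$ almost surely as $n\to\infty$, and $$P\big(I_\infty\in\{0,1\}\big)=1 .$$ -/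

import Mathlib

open MeasureTheory ProbabilityTheory Filter Topology

universe u

/-- A discrete memoryless channel `W` with input alphabet `X`: an at most countable output alphabet
`Out` and a conditional probability distribution `prob y x = W(y ∣ x)`. -/
structure DMC (X : Type u) where
  Out : Type u
  countable_out : Countable Out
  prob : Out → X → ℝ
  prob_nonneg : ∀ y x, 0 ≤ prob y x
  hasSum_prob : ∀ x, HasSum (fun y => prob y x) 1

namespace DMC

/-- The symmetric capacity `I(W)`, with logarithms to base `q = |X|`. -/
noncomputable def symmetricCapacity {X : Type u} [Fintype X] (W : DMC X) : ℝ :=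
  ∑ x : X, ∑' y : W.Out, (1 / (Fintype.card X : ℝ)) * W.prob y x *
    Real.logb (Fintype.card X)
      (W.prob y x / ((1 / (Fintype.card X : ℝ)) * ∑ x' : X, W.prob y x'))

/-- The transition probability of the `ℓ`-fold product channel `W^ℓ`. -/
def powProb {X : Type u} {ℓ : ℕ} (W : DMC X) (y : Fin ℓ → W.Out) (x : Fin ℓ → X) : ℝ :=
  ∏ j, W.prob (y j) (x j)

/-- The vector `(u_0, …, u_{i-1}, u_i, u_{i+1}, …, u_{ℓ-1})` assembled from its past, its `i`-th
entry and its future. -/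
def glue {X : Type u} {ℓ : ℕ} (i : Fin ℓ) (past : Set.Iio i → X) (x : X)
    (future : Set.Ioi i → X) : Fin ℓ → X := fun j =>
  if h : j < i then past ⟨j, h⟩ else if h' : i < j then future ⟨j, h'⟩ else x

/-- The transition probability of `W^{(i)}`: the output is `(y_0^{ℓ-1}, u_0^{i-1})`, the input is
`u_i`, and the future `u_{i+1}^{ℓ-1}` is summed out. -/
noncomputable def subchannelProb {X : Type u} [Fintype X] {ℓ : ℕ}
    (g : (Fin ℓ → X) → (Fin ℓ → X)) (W : DMC X) (i : Fin ℓ)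
    (o : (Fin ℓ → W.Out) × (Set.Iio i → X)) (x : X) : ℝ :=
  (1 / (Fintype.card X : ℝ) ^ (ℓ - 1)) *
    ∑ future : Set.Ioi i → X, W.powProb o.1 (g (glue i o.2 x future))

theorem powProb_nonneg {X : Type u} {ℓ : ℕ} (W : DMC X) (y : Fin ℓ → W.Out) (x : Fin ℓ → X) :
    0 ≤ W.powProb y x :=
  Finset.prod_nonneg fun _ _ => W.prob_nonneg _ _

theorem hasSum_pi_prod {Y : Type u} : ∀ (n : ℕ) (f : Fin n → Y → ℝ),
    (∀ j y, 0 ≤ f j y) → (∀ j, HasSum (f j) 1) →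
    HasSum (fun y : Fin n → Y => ∏ j, f j (y j)) 1
  | 0, f, _, _ => by
    simp
  | n + 1, f, h0, h1 => by
    have ih := hasSum_pi_prod n (fun j => f j.succ) (fun j => h0 _) (fun j => h1 _)
    have hs := (h1 0).summable.mul_of_nonneg ih.summable (fun y => h0 0 y)
      (fun y => Finset.prod_nonneg fun j _ => h0 _ _)
    have h := (h1 0).mul ih hs
    rw [← (Fin.consEquiv fun _ => Y).hasSum_iff]
    simpa [Function.comp_def, Fin.prod_univ_succ, Fin.consEquiv] using h

theorem hasSum_powProb {X : Type u} {ℓ : ℕ} (W : DMC X) (x : Fin ℓ → X) :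
    HasSum (fun y : Fin ℓ → W.Out => W.powProb y x) 1 :=
  hasSum_pi_prod ℓ (fun j y => W.prob y (x j)) (fun _ _ => W.prob_nonneg _ _)
    (fun _ => W.hasSum_prob _)

theorem hasSum_prod_fintype {A : Type u} {P : Type u} [Fintype P] (f : A × P → ℝ) (s : P → ℝ)
    (h : ∀ p, HasSum (fun a => f (a, p)) (s p)) : HasSum f (∑ p, s p) := by
  classical
  have key : HasSum (fun o : A × P => ∑ p, if o.2 = p then f o else 0) (∑ p, s p) := by
    refine hasSum_sum fun p _ => ?_
    have hinj : Function.Injective (fun a : A => (a, p)) := fun a b hab => (Prod.ext_iff.1 hab).1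
    rw [← hinj.hasSum_iff]
    · simpa [Function.comp_def] using h p
    · rintro ⟨a, p'⟩ hp
      rw [if_neg]
      rintro rfl
      exact hp ⟨a, rfl⟩
  simpa using key

theorem hasSum_subchannelProb {X : Type u} [Fintype X] {ℓ : ℕ}
    (g : (Fin ℓ → X) → (Fin ℓ → X)) (W : DMC X) (i : Fin ℓ) (x : X) :
    HasSum (fun o => subchannelProb g W i o x) 1 := by
  classical
  have h := hasSum_prod_fintype (fun o => subchannelProb g W i o x)
    (fun _ => (1 / (Fintype.card X : ℝ) ^ (ℓ - 1)) * ∑ _future : Set.Ioi i → X, (1 : ℝ))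
    (fun p => (hasSum_sum fun future _ => W.hasSum_powProb (g (glue i p x future))).mul_left _)
  convert h using 1
  have hq : (Fintype.card X : ℝ) ≠ 0 := by
    have : Nonempty X := ⟨x⟩
    exact_mod_cast Fintype.card_ne_zero
  have hc : (i : ℕ) + (ℓ - 1 - i) = ℓ - 1 := by have := i.2; omega
  simp
  field_simp
  rw [← pow_add, hc]

/-- The channel `W^{(i)} : X → Out^ℓ × X^i` obtained from `W` with the kernel `g`. -/
noncomputable def subchannel {X : Type u} [Fintype X] {ℓ : ℕ}
    (g : (Fin ℓ → X) → (Fin ℓ → X)) (W : DMC X) (i : Fin ℓ) : DMC X where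
  Out := (Fin ℓ → W.Out) × (Set.Iio i → X)
  countable_out := by
    have := W.countable_out
    infer_instance
  prob := subchannelProb g W i
  prob_nonneg := fun _ _ =>
    mul_nonneg (by positivity) (Finset.sum_nonneg fun _ _ => W.powProb_nonneg _ _)
  hasSum_prob := hasSum_subchannelProb g W i

/-- `iterSubchannel g W b n` is the channel `W^{(b_0)(b_1)⋯(b_{n-1})}`. -/
noncomputable def iterSubchannel {X : Type u} [Fintype X] {ℓ : ℕ}
    (g : (Fin ℓ → X) → (Fin ℓ → X)) (W : DMC X) (b : ℕ → Fin ℓ) : ℕ → DMC X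
  | 0 => W
  | n + 1 => (iterSubchannel g W b n).subchannel g (b n)

end DMC

/-! Let `H` be the entropy of the uniform input given the output, so that `I = 1 - H / log q`. For a
bijective kernel the chain rule makes the average of `I` over the `ℓ` subchannels equal to `I`.
Along uniformly random indices the capacity is therefore a bounded martingale and converges almost
surely. It remains to find one index whose move raises the capacity by an amount depending only on
`ε`, whenever the capacity lies in `(ε, 1 - ε)`: since increments tend to zero, the limit cannot lie
there. The bound must be uniform over all channels, because output alphabets grow along the process.

The index is `k`. The normal form gives two coordinates `a`, `b` of the codeword such that, with the
past known, coordinate `a` is an affine bijective function of the input `u_k`, and coordinate `b` is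
a known `s` plus `α` times coordinate `a`, where `α = G k j` (`exists_shear_of_normal_form`). So
`u_k` is seen through two uses of `W`. With `X_a`, `X_b` independent given their outputs, the
remaining uncertainty is at most `H(X_a | S)` for `S = X_b - α X_a`, that is `H(X_a) + H(X_b) -
H(S)`. A strong form of Jensen's inequality bounds `H(S) - H(X_b)` from below by a quarter of `M 0 -
∑ d, M d * M (α * d)`, where `M` is the law of the difference of two independent samples from the
posterior (`condEntropy_subchannel_le`).

As `M ≤ M 0` and `∑ M = 1`, a small gap means that `M (α * d)` is close to `M 0` whenever `M d` is
not small. Multiplication by the primitive element `α` is transitive on nonzero elements, so `M` is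
nearly uniform or nearly concentrated at `0` (`corr_dichotomy`). Then `I` is near `0` or near `1`.
-/

/-! ### Scalar entropy inequalities -/

open Real in
-- Multiply `log y ≤ y - 1` at `y = √m / √t` by `2 * t`. This is the tangent-line bound for the
-- concave function `negMulLog` at `m`, with a Hellinger remainder that supplies the quadratic gain
-- below.
theorem negMulLog_le_sub_sq_sqrt {t m : ℝ} (ht : 0 ≤ t) (hm : 0 < m) :
    negMulLog t ≤ -t * log m + m - t - (√t - √m) ^ 2 := by
  rcases ht.eq_or_lt with rfl | ht
  · simp [Real.sq_sqrt hm.le]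
  · have hst : 0 < √t := Real.sqrt_pos.2 ht
    have hsm : 0 < √m := Real.sqrt_pos.2 hm
    have h1 : log (√m / √t) ≤ √m / √t - 1 := Real.log_le_sub_one_of_pos (by positivity)
    rw [Real.log_div hsm.ne' hst.ne', Real.log_sqrt hm.le, Real.log_sqrt ht.le] at h1
    have h2 : t * (√m / √t) = √t * √m := by
      have : t = √t * √t := (Real.mul_self_sqrt ht.le).symm
      field_simp
      nlinarith
    have h3 := mul_le_mul_of_nonneg_left h1 ht.le
    have h4 := Real.sq_sqrt ht.le
    have h5 := Real.sq_sqrt hm.le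
    unfold negMulLog
    nlinarith

open Real in
theorem negMulLog_le_of_pos {t m : ℝ} (ht : 0 ≤ t) (hm : 0 < m) :
    negMulLog t ≤ -t * log m + m - t := by
  have := negMulLog_le_sub_sq_sqrt ht hm
  nlinarith [sq_nonneg (√t - √m)]

open Real in
theorem negMulLog_le_sub_sq {t m : ℝ} (ht : 0 ≤ t) (ht1 : t ≤ 1) (hm : 0 < m) (hm1 : m ≤ 1) :
    negMulLog t ≤ -t * log m + m - t - 1 / 4 * (t - m) ^ 2 := by
  have h := negMulLog_le_sub_sq_sqrt ht hm
  have h1 : √t ≤ 1 := Real.sqrt_le_one.2 ht1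
  have h2 : √m ≤ 1 := Real.sqrt_le_one.2 hm1
  have h3 : (t - m) ^ 2 = (√t - √m) ^ 2 * (√t + √m) ^ 2 := by
    rw [← mul_pow, mul_comm, ← sq_sub_sq, Real.sq_sqrt ht, Real.sq_sqrt hm.le]
  have h4 : (√t + √m) ^ 2 ≤ 4 := by
    nlinarith [Real.sqrt_nonneg t, Real.sqrt_nonneg m]
  nlinarith [mul_le_mul_of_nonneg_left h4 (sq_nonneg (√t - √m))]

open Real in
-- `negMulLog` has infinite slope at `0`, so no multiple of `x * (1 - x)` dominates it; the slack
-- `η` repairs this. The bound stays linear in `x * (1 - x)`, hence survives averaging over outputs.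
theorem negMulLog_le_mul_one_sub_div_add {x η : ℝ} (hx : 0 ≤ x) (hx1 : x ≤ 1) (hη : 0 < η) :
    negMulLog x ≤ x * (1 - x) / η + η := by
  rcases hx.eq_or_lt with rfl | hx
  · simpa using hη.le
  · have hs : 0 < √x := Real.sqrt_pos.2 hx
    have hs1 : √x ≤ 1 := Real.sqrt_le_one.2 hx1
    have h4 := Real.sq_sqrt hx.le
    have h1 : negMulLog x ≤ 2 * (√x * (1 - √x)) := by
      have := negMulLog_le_sub_sq_sqrt hx.le one_pos
      simp only [log_one, sqrt_one] at this
      nlinarith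
    have h2 : 2 * (√x * (1 - √x)) ≤ x * (1 - √x) ^ 2 / η + η := by
      rw [div_add' _ _ _ hη.ne', le_div_iff₀ hη]
      nlinarith [sq_nonneg (√x * (1 - √x) - η)]
    have h3 : x * (1 - √x) ^ 2 / η ≤ x * (1 - x) / η := by
      gcongr
      nlinarith
    linarith

open Real in
theorem negMulLog_prod {ι : Type*} [Fintype ι] [DecidableEq ι] (t : ι → ℝ) :
    negMulLog (∏ j, t j) = ∑ j, negMulLog (t j) * ∏ j' ∈ Finset.univ.erase j, t j' := by
  by_cases h : ∀ j, t j ≠ 0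
  · unfold negMulLog
    rw [Real.log_prod fun j _ => h j, Finset.mul_sum]
    refine Finset.sum_congr rfl fun j _ => ?_
    rw [← Finset.mul_prod_erase Finset.univ t (Finset.mem_univ j)]
    ring
  · push Not at h
    obtain ⟨i, hi⟩ := h
    rw [Finset.prod_eq_zero (Finset.mem_univ i) hi, negMulLog_zero, Finset.sum_eq_zero]
    intro j _
    by_cases hj : j = i
    · simp [hj, hi]
    · rw [Finset.prod_eq_zero (i := i) (by simp [Ne.symm hj]) hi, mul_zero]

/-- The entropy of a finite measure `w`, extended to be homogeneous of degree one. -/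
noncomputable def homEntropy {ι : Type*} [Fintype ι] (w : ι → ℝ) : ℝ :=
  ∑ x, Real.negMulLog (w x) - Real.negMulLog (∑ x, w x)

/-! ### Entropy of finite measures -/

section homEntropy

open Real

variable {ι κ : Type*} [Fintype ι] [Fintype κ]

theorem homEntropy_mul (c : ℝ) (w : ι → ℝ) :
    homEntropy (fun x => c * w x) = c * homEntropy w := by
  unfold homEntropy
  simp only [negMulLog_mul, ← Finset.mul_sum, Finset.sum_add_distrib, ← Finset.sum_mul]
  ring

theorem homEntropy_comp_equiv (e : κ ≃ ι) (w : ι → ℝ) :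
    homEntropy (fun x => w (e x)) = homEntropy w := by
  unfold homEntropy
  rw [Equiv.sum_comp e w, Equiv.sum_comp e fun x => negMulLog (w x)]

theorem homEntropy_eq_sum (w : ι → ℝ) :
    homEntropy w = ∑ x, (negMulLog (w x) + w x * log (∑ x', w x')) := by
  unfold homEntropy
  rw [Finset.sum_add_distrib, ← Finset.sum_mul, negMulLog]
  ring

theorem negMulLog_add_mul_log_sum_nonneg {w : ι → ℝ} (hw : ∀ x, 0 ≤ w x) (x : ι) :
    0 ≤ negMulLog (w x) + w x * log (∑ x', w x') := by
  rcases (hw x).eq_or_lt with h | h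
  · simp [← h]
  · have h1 : log (w x) ≤ log (∑ x', w x') :=
      log_le_log h (Finset.single_le_sum (fun i _ => hw i) (Finset.mem_univ x))
    unfold negMulLog
    nlinarith

theorem negMulLog_add_mul_log_sum_le {w : ι → ℝ} (hw : ∀ x, 0 ≤ w x) (x : ι) :
    negMulLog (w x) + w x * log (∑ x', w x') ≤ ∑ x', w x' := by
  rcases (hw x).eq_or_lt with h | h
  · simpa [← h] using Finset.sum_nonneg fun i _ => hw i
  · have hs : 0 < ∑ x', w x' :=
      h.trans_le (Finset.single_le_sum (fun i _ => hw i) (Finset.mem_univ x))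
    have := negMulLog_le_of_pos h.le hs
    linarith

theorem homEntropy_nonneg {w : ι → ℝ} (hw : ∀ x, 0 ≤ w x) : 0 ≤ homEntropy w := by
  rw [homEntropy_eq_sum]
  exact Finset.sum_nonneg fun x _ => negMulLog_add_mul_log_sum_nonneg hw x

theorem homEntropy_le_card_mul {w : ι → ℝ} (hw : ∀ x, 0 ≤ w x) :
    homEntropy w ≤ Fintype.card ι * ∑ x, w x := by
  rw [homEntropy_eq_sum]
  refine (Finset.sum_le_sum fun x _ => negMulLog_add_mul_log_sum_le hw x).trans ?_
  simp

/-- Gibbs' inequality. -/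
theorem homEntropy_le_cross {w v : ι → ℝ} (hw : ∀ x, 0 ≤ w x) (hv : ∀ x, 0 ≤ v x)
    (hwv : ∀ x, v x = 0 → w x = 0) :
    homEntropy w ≤ ∑ x, -w x * log (v x) + (∑ x, w x) * log (∑ x, v x) := by
  rcases (Finset.sum_nonneg fun x _ => hw x : (0 : ℝ) ≤ ∑ x, w x).eq_or_lt with h | h
  · have h0 : ∀ x, w x = 0 := fun x =>
      (Finset.sum_eq_zero_iff_of_nonneg fun i _ => hw i).1 h.symm x (Finset.mem_univ x)
    simp [homEntropy, h0]
  · have hV : 0 < ∑ x, v x := by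
      refine (Finset.sum_nonneg fun x _ => hv x).lt_of_ne fun h' => h.ne' ?_
      exact Finset.sum_eq_zero fun x _ => hwv x
        ((Finset.sum_eq_zero_iff_of_nonneg fun i _ => hv i).1 h'.symm x (Finset.mem_univ x))
    set a := ∑ x, w x with ha
    set b := ∑ x, v x with hb
    have key : ∀ x, negMulLog (w x) ≤
        -w x * log (v x) - w x * log a + w x * log b + v x * (a / b) - w x := by
      intro x
      rcases (hv x).eq_or_lt with hx | hx
      · simp [hwv x hx.symm, ← hx]
      · have := negMulLog_le_of_pos (hw x) (show 0 < v x * (a / b) by positivity)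
        rw [log_mul hx.ne' (by positivity), log_div h.ne' hV.ne'] at this
        linarith
    have hs := Finset.sum_le_sum fun x (_ : x ∈ Finset.univ) => key x
    simp only [Finset.sum_add_distrib, Finset.sum_sub_distrib, ← Finset.sum_mul, ← ha, ← hb] at hs
    have : b * (a / b) = a := by field_simp
    unfold homEntropy
    rw [← ha, negMulLog]
    linarith

/-- Conditioning reduces entropy: apply Gibbs' inequality to each `w i` against the total measure.
It is used to forget part of the past. -/
theorem sum_homEntropy_le {σ : Type*} (s : Finset σ) {w : σ → ι → ℝ}
    (hw : ∀ i x, 0 ≤ w i x) :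
    ∑ i ∈ s, homEntropy (w i) ≤ homEntropy (fun x => ∑ i ∈ s, w i x) := by
  have hV : ∀ x, 0 ≤ ∑ i ∈ s, w i x := fun x => Finset.sum_nonneg fun i _ => hw i x
  refine (Finset.sum_le_sum fun i hi => homEntropy_le_cross (hw i) hV fun x hx =>
    (Finset.sum_eq_zero_iff_of_nonneg fun i _ => hw i x).1 hx i hi).trans_eq ?_
  unfold homEntropy
  rw [Finset.sum_add_distrib, Finset.sum_comm, ← Finset.sum_mul, Finset.sum_comm (s := s)]
  simp only [← Finset.sum_mul, Finset.sum_neg_distrib, negMulLog]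
  ring

theorem homEntropy_le_log_card_mul [Nonempty ι] {w : ι → ℝ} (hw : ∀ x, 0 ≤ w x) :
    homEntropy w ≤ log (Fintype.card ι) * ∑ x, w x := by
  have := homEntropy_le_cross (v := fun _ => 1) hw (by simp) (by simp)
  simpa [mul_comm] using this

/-- Relative entropy to the uniform law is at most the chi-square divergence, by `log y ≤ y - 1`. A
collision probability near `1 / q` thus forces nearly full entropy. -/
theorem log_card_mul_sub_homEntropy_le {w : ι → ℝ} (hw : ∀ x, 0 ≤ w x) :
    log (Fintype.card ι) * ∑ x, w x - homEntropy w ≤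
      Fintype.card ι * ((∑ x, w x * w x) / ∑ x, w x) - ∑ x, w x := by
  rcases (Finset.sum_nonneg fun x _ => hw x : (0 : ℝ) ≤ ∑ x, w x).eq_or_lt with h | h
  · have h0 : ∀ x, w x = 0 := fun x =>
      (Finset.sum_eq_zero_iff_of_nonneg fun i _ => hw i).1 h.symm x (Finset.mem_univ x)
    simp [homEntropy, h0]
  · have : Nonempty ι := by
      by_contra hn
      rw [not_nonempty_iff] at hn
      simp at h
    have hc : (0 : ℝ) < Fintype.card ι := by exact_mod_cast Fintype.card_pos
    rw [homEntropy_eq_sum]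
    set a := ∑ x, w x with ha
    have key : ∀ x, w x * log (Fintype.card ι) - (negMulLog (w x) + w x * log a) ≤
        Fintype.card ι * (w x * w x) / a - w x := by
      intro x
      rcases (hw x).eq_or_lt with hx | hx
      · simp [← hx]
      · have h1 := Real.log_le_sub_one_of_pos (show 0 < Fintype.card ι * w x / a by positivity)
        rw [log_div (by positivity) h.ne', log_mul hc.ne' hx.ne'] at h1
        have h2 := mul_le_mul_of_nonneg_left h1 hx.le
        have h3 : w x * (Fintype.card ι * w x / a - 1) = Fintype.card ι * (w x * w x) / a - w x := by
          ring
        unfold negMulLog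
        linarith
    have hs := Finset.sum_le_sum fun x (_ : x ∈ Finset.univ) => key x
    rw [Finset.sum_sub_distrib, Finset.sum_sub_distrib, ← Finset.sum_mul, ← Finset.sum_div,
      ← Finset.mul_sum, ← ha] at hs
    rw [mul_comm, ← mul_div_assoc]
    exact hs

theorem homEntropy_le_of_pos {w : ι → ℝ} (hw : ∀ x, 0 ≤ w x) {η : ℝ} (hη : 0 < η) :
    homEntropy w ≤ ((∑ x, w x) - (∑ x, w x * w x) / ∑ x, w x) / η
      + Fintype.card ι * η * ∑ x, w x := by
  rcases (Finset.sum_nonneg fun x _ => hw x : (0 : ℝ) ≤ ∑ x, w x).eq_or_lt with h | h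
  · have h0 : ∀ x, w x = 0 := fun x =>
      (Finset.sum_eq_zero_iff_of_nonneg fun i _ => hw i).1 h.symm x (Finset.mem_univ x)
    simp [homEntropy, h0]
  · set a := ∑ x, w x with ha
    have h1 : homEntropy w = a * homEntropy (fun x => a⁻¹ * w x) := by
      rw [homEntropy_mul, mul_inv_cancel_left₀ h.ne']
    have hsum : ∑ x, a⁻¹ * w x = 1 := by rw [← Finset.mul_sum, ← ha, inv_mul_cancel₀ h.ne']
    have h2 : homEntropy (fun x => a⁻¹ * w x) ≤
        ∑ x, (a⁻¹ * w x * (1 - a⁻¹ * w x) / η + η) := by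
      unfold homEntropy
      rw [hsum, negMulLog_one, sub_zero]
      refine Finset.sum_le_sum fun x _ => negMulLog_le_mul_one_sub_div_add
        (mul_nonneg (inv_nonneg.2 h.le) (hw x)) ?_ hη
      rw [← hsum]
      exact Finset.single_le_sum (f := fun x => a⁻¹ * w x)
        (fun i _ => mul_nonneg (inv_nonneg.2 h.le) (hw i)) (Finset.mem_univ x)
    rw [h1]
    refine (mul_le_mul_of_nonneg_left h2 h.le).trans_eq ?_
    rw [Finset.sum_add_distrib, ← Finset.sum_div]
    simp only [mul_sub, mul_one, Finset.sum_sub_distrib, hsum]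
    have : ∑ x, a⁻¹ * w x * (a⁻¹ * w x) = a⁻¹ * a⁻¹ * ∑ x, w x * w x := by
      rw [Finset.mul_sum]
      exact Finset.sum_congr rfl fun x _ => by ring
    rw [this]
    simp
    field_simp

theorem sum_pi_prod {κ : Type*} [DecidableEq ι] [Fintype κ] (w : ι → κ → ℝ) :
    ∑ x : ι → κ, ∏ j, w j (x j) = ∏ j, ∑ t, w j t := by
  rw [Finset.prod_univ_sum, Fintype.piFinset_univ]

theorem homEntropy_pi [DecidableEq ι] (w : ι → κ → ℝ) :
    homEntropy (fun x : ι → κ => ∏ j, w j (x j)) =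
      ∑ j, homEntropy (w j) * ∏ j' ∈ Finset.univ.erase j, ∑ t, w j' t := by
  have h (j : ι) : ∑ x : ι → κ, negMulLog (w j (x j)) * ∏ j' ∈ Finset.univ.erase j, w j' (x j') =
      (∑ t, negMulLog (w j t)) * ∏ j' ∈ Finset.univ.erase j, ∑ t, w j' t := by
    have := sum_pi_prod (Function.update w j fun t => negMulLog (w j t))
    rw [← Finset.mul_prod_erase _ _ (Finset.mem_univ j)] at this
    simp only [← Finset.mul_prod_erase Finset.univ _ (Finset.mem_univ j),
      Function.update_self] at this
    convert this using 2
    · refine congrArg _ (Finset.prod_congr rfl fun j' hj' => ?_)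
      rw [Function.update_of_ne (Finset.ne_of_mem_erase hj')]
    · refine Finset.prod_congr rfl fun j' hj' => ?_
      rw [Function.update_of_ne (Finset.ne_of_mem_erase hj')]
  unfold homEntropy
  simp only [sub_mul, Finset.sum_sub_distrib]
  rw [sum_pi_prod, negMulLog_prod]
  simp only [negMulLog_prod (fun j => w j _)]
  rw [Finset.sum_comm]
  simp only [h]

end homEntropy

/-! ### Autocorrelation and the entropy gain of a shear -/

section autocorrelation

open Real

variable {F : Type*} [Fintype F]

/-- The autocorrelation of a function on a finite additive group. -/
def autocorr [Add F] (w : F → ℝ) (d : F) : ℝ := ∑ x, w x * w (x + d)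

theorem autocorr_nonneg [Add F] {w : F → ℝ} (hw : ∀ x, 0 ≤ w x) (d : F) : 0 ≤ autocorr w d :=
  Finset.sum_nonneg fun _ _ => mul_nonneg (hw _) (hw _)

theorem autocorr_mul [Add F] (c : ℝ) (w : F → ℝ) (d : F) :
    autocorr (fun x => c * w x) d = c * c * autocorr w d := by
  unfold autocorr
  rw [Finset.mul_sum]
  exact Finset.sum_congr rfl fun x _ => by ring

theorem autocorr_zero_right [AddGroup F] (w : F → ℝ) : autocorr w 0 = ∑ x, w x * w x := by
  simp [autocorr]

theorem autocorr_le_autocorr_zero [AddGroup F] (w : F → ℝ) (d : F) :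
    autocorr w d ≤ autocorr w 0 := by
  have h : ∑ x, w (x + d) * w (x + d) = ∑ x, w x * w x :=
    Equiv.sum_comp (Equiv.addRight d) fun x => w x * w x
  have h2 : ∑ x, w x * w (x + d) ≤ ∑ x, (w x * w x + w (x + d) * w (x + d)) / 2 :=
    Finset.sum_le_sum fun x _ => by nlinarith [sq_nonneg (w x - w (x + d))]
  rw [autocorr_zero_right]
  rw [← Finset.sum_div, Finset.sum_add_distrib, h] at h2
  unfold autocorr
  linarith

theorem sum_autocorr [AddGroup F] (w : F → ℝ) : ∑ d, autocorr w d = (∑ x, w x) * ∑ x, w x := by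
  unfold autocorr
  rw [Finset.sum_comm, Finset.sum_mul]
  refine Finset.sum_congr rfl fun x _ => ?_
  rw [← Finset.mul_sum, ← Equiv.sum_comp (Equiv.addLeft x) w]
  rfl

theorem autocorr_le_sq [AddGroup F] {w : F → ℝ} (hw : ∀ x, 0 ≤ w x) (d : F) :
    autocorr w d ≤ (∑ x, w x) * ∑ x, w x := by
  rw [← sum_autocorr]
  exact Finset.single_le_sum (fun i _ => autocorr_nonneg hw i) (Finset.mem_univ d)

/-- Expand the square with the second index written as `x + d`; summing over `s` absorbs the shift
`α * x`, leaving autocorrelations only. -/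
theorem sum_shear_sq [Field F] (p r : F → ℝ) (α : F) :
    ∑ s, (∑ x, p x * r (s + α * x)) ^ 2 = ∑ d, autocorr p d * autocorr r (α * d) := by
  have h1 : ∀ x d, ∑ s, (p x * r (s + α * x)) * (p (x + d) * r (s + α * (x + d))) =
      p x * p (x + d) * autocorr r (α * d) := by
    intro x d
    unfold autocorr
    rw [← Equiv.sum_comp (Equiv.addRight (α * x)) fun t => r t * r (t + α * d), Finset.mul_sum]
    refine Finset.sum_congr rfl fun s _ => ?_
    simp only [Equiv.coe_addRight]
    rw [show s + α * x + α * d = s + α * (x + d) by ring]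
    ring
  calc ∑ s, (∑ x, p x * r (s + α * x)) ^ 2
      = ∑ s, ∑ x, ∑ d, (p x * r (s + α * x)) * (p (x + d) * r (s + α * (x + d))) := by
        refine Finset.sum_congr rfl fun s _ => ?_
        rw [sq, Finset.sum_mul_sum]
        refine Finset.sum_congr rfl fun x _ => ?_
        rw [← Equiv.sum_comp (Equiv.addLeft x)]
        rfl
    _ = ∑ x, ∑ d, p x * p (x + d) * autocorr r (α * d) := by
        rw [Finset.sum_comm]
        refine Finset.sum_congr rfl fun x _ => ?_
        rw [Finset.sum_comm]
        exact Finset.sum_congr rfl fun d _ => h1 x d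
    _ = ∑ d, autocorr p d * autocorr r (α * d) := by
        rw [Finset.sum_comm]
        refine Finset.sum_congr rfl fun d _ => ?_
        rw [← Finset.sum_mul]
        rfl

/-- The law of `S` is a `p`-mixture of shifts of `r`. Jensen's inequality with the quadratic
remainder of `negMulLog_le_sub_sq` gains a quarter of the variance of the mixture at each `s`; the
variances add up to the autocorrelation gap. -/
theorem sum_negMulLog_shear_ge [Field F] {p r : F → ℝ} (hp : ∀ x, 0 ≤ p x) (hr : ∀ x, 0 ≤ r x)
    (hp1 : ∑ x, p x = 1) (hr1 : ∑ x, r x = 1) (α : F) :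
    ∑ x, negMulLog (r x) +
        1 / 4 * (autocorr r 0 - ∑ d, autocorr p d * autocorr r (α * d)) ≤
      ∑ s, negMulLog (∑ x, p x * r (s + α * x)) := by
  have hr_le (x : F) : r x ≤ 1 := by
    rw [← hr1]; exact Finset.single_le_sum (fun i _ => hr i) (Finset.mem_univ x)
  have key (s : F) : ∑ x, p x * negMulLog (r (s + α * x)) +
      1 / 4 * (∑ x, p x * (r (s + α * x) * r (s + α * x)) - (∑ x, p x * r (s + α * x)) ^ 2) ≤
      negMulLog (∑ x, p x * r (s + α * x)) := by
    have hm0 : 0 ≤ ∑ x, p x * r (s + α * x) :=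
      Finset.sum_nonneg fun x _ => mul_nonneg (hp _) (hr _)
    have hm1 : ∑ x, p x * r (s + α * x) ≤ 1 := by
      rw [← hp1]
      exact Finset.sum_le_sum fun x _ => mul_le_of_le_one_right (hp x) (hr_le _)
    rcases hm0.eq_or_lt with h | h
    · have h0 : ∀ x, p x * r (s + α * x) = 0 := fun x =>
        (Finset.sum_eq_zero_iff_of_nonneg fun i _ => mul_nonneg (hp _) (hr _)).1 h.symm x
          (Finset.mem_univ x)
      have h1 : ∀ x, p x * negMulLog (r (s + α * x)) = 0 := fun x => by
        unfold negMulLog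
        rw [show p x * (-r (s + α * x) * log (r (s + α * x))) =
          -(p x * r (s + α * x)) * log (r (s + α * x)) by ring, h0]
        simp
      simp [h0, h1, ← mul_assoc]
    · set m := ∑ x, p x * r (s + α * x) with hm
      have hx (x : F) : p x * negMulLog (r (s + α * x)) ≤
          -(p x * r (s + α * x)) * log m + p x * m - p x * r (s + α * x) - 1 / 4 *
          (p x * (r (s + α * x) * r (s + α * x)) - p x * r (s + α * x) * (2 * m)
            + p x * m ^ 2) := by
        have := mul_le_mul_of_nonneg_left
          (negMulLog_le_sub_sq (hr (s + α * x)) (hr_le _) h hm1) (hp x)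
        refine this.trans_eq ?_
        ring
      have hs := Finset.sum_le_sum fun x (_ : x ∈ Finset.univ) => hx x
      simp only [Finset.sum_add_distrib, Finset.sum_sub_distrib, ← Finset.sum_mul,
        ← Finset.mul_sum, Finset.sum_neg_distrib, ← hm, hp1] at hs
      unfold negMulLog at hs ⊢
      linarith
  have hs := Finset.sum_le_sum fun s (_ : s ∈ Finset.univ) => key s
  have hshift (f : F → ℝ) : ∑ s, ∑ x, p x * f (s + α * x) = ∑ x, f x := by
    rw [Finset.sum_comm]
    have (x : F) : ∑ s, p x * f (s + α * x) = p x * ∑ s, f s := by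
      rw [← Finset.mul_sum, ← Equiv.sum_comp (Equiv.addRight (α * x)) f]
      rfl
    simp only [this, ← Finset.sum_mul, hp1, one_mul]
  rw [Finset.sum_add_distrib, ← Finset.mul_sum, Finset.sum_sub_distrib, sum_shear_sq,
    hshift fun t => negMulLog (r t), hshift fun t => r t * r t, ← autocorr_zero_right] at hs
  exact hs

/-- The pair `(X_a, S)` determines `(X_a, X_b)`, so `H(X_a | S) = H(p) + H(r) - H(S)`. -/
theorem sum_homEntropy_shear_le_of_sum_eq_one [Field F] {p r : F → ℝ} (hp : ∀ x, 0 ≤ p x)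
    (hr : ∀ x, 0 ≤ r x) (hp1 : ∑ x, p x = 1) (hr1 : ∑ x, r x = 1) (α : F) :
    ∑ s, homEntropy (fun x => p x * r (s + α * x)) ≤
      homEntropy p - 1 / 4 * (autocorr r 0 - ∑ d, autocorr p d * autocorr r (α * d)) := by
  have h := sum_negMulLog_shear_ge hp hr hp1 hr1 α
  have hshift (f : F → ℝ) (x : F) : ∑ s, f (s + α * x) = ∑ s, f s :=
    Equiv.sum_comp (Equiv.addRight (α * x)) f
  unfold homEntropy
  rw [Finset.sum_sub_distrib, Finset.sum_comm, hp1, negMulLog_one]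
  simp only [negMulLog_mul, Finset.sum_add_distrib, ← Finset.mul_sum, ← Finset.sum_mul]
  simp only [hshift r, hshift fun t => negMulLog (r t), hr1, one_mul]
  rw [← Finset.sum_mul, hp1]
  linarith

theorem sum_homEntropy_shear_le [Field F] {p r : F → ℝ} (hp : ∀ x, 0 ≤ p x)
    (hr : ∀ x, 0 ≤ r x) (α : F) :
    ∑ s, homEntropy (fun x => p x * r (s + α * x)) ≤
      homEntropy p * (∑ x, r x) - 1 / 4 * ((∑ x, p x) * (autocorr r 0 / ∑ x, r x) -
        ∑ d, autocorr p d / (∑ x, p x) * (autocorr r (α * d) / ∑ x, r x)) := by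
  have zero {w : F → ℝ} (hw : ∀ x, 0 ≤ w x) (h : 0 = ∑ x, w x) (x : F) : w x = 0 :=
    (Finset.sum_eq_zero_iff_of_nonneg fun i _ => hw i).1 h.symm x (Finset.mem_univ x)
  rcases (Finset.sum_nonneg fun x _ => hp x : (0 : ℝ) ≤ ∑ x, p x).eq_or_lt with h | hP
  · simp [zero hp h, homEntropy]
  rcases (Finset.sum_nonneg fun x _ => hr x : (0 : ℝ) ≤ ∑ x, r x).eq_or_lt with h | hR
  · simp [zero hr h, homEntropy]
  set P := ∑ x, p x with hPd
  set R := ∑ x, r x with hRd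
  have h := sum_homEntropy_shear_le_of_sum_eq_one (p := fun x => P⁻¹ * p x)
    (r := fun x => R⁻¹ * r x) (fun x => mul_nonneg (inv_nonneg.2 hP.le) (hp x))
    (fun x => mul_nonneg (inv_nonneg.2 hR.le) (hr x))
    (by rw [← Finset.mul_sum, ← hPd, inv_mul_cancel₀ hP.ne'])
    (by rw [← Finset.mul_sum, ← hRd, inv_mul_cancel₀ hR.ne']) α
  have e0 (s : F) : homEntropy (fun x => P⁻¹ * p x * (R⁻¹ * r (s + α * x))) =
      P⁻¹ * R⁻¹ * homEntropy (fun x => p x * r (s + α * x)) := by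
    rw [← homEntropy_mul]
    exact congrArg _ (funext fun x => by ring)
  have e1 : ∑ d, autocorr p d / P * (autocorr r (α * d) / R) =
      P⁻¹ * R⁻¹ * ∑ d, autocorr p d * autocorr r (α * d) := by
    rw [Finset.mul_sum]
    exact Finset.sum_congr rfl fun d _ => by field_simp
  have e2 : ∑ d, P⁻¹ * P⁻¹ * autocorr p d * (R⁻¹ * R⁻¹ * autocorr r (α * d)) =
      P⁻¹ * P⁻¹ * (R⁻¹ * R⁻¹) * ∑ d, autocorr p d * autocorr r (α * d) := by
    rw [Finset.mul_sum]
    exact Finset.sum_congr rfl fun d _ => by ring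
  simp only [e0, homEntropy_mul, autocorr_mul, ← Finset.mul_sum, e2] at h
  rw [e1]
  refine le_trans (le_of_eq ?_) ((mul_le_mul_of_nonneg_left h (mul_pos hP hR).le).trans_eq ?_)
  · field_simp
  · field_simp

end autocorrelation

/-! ### Chain rule for vectors -/

namespace DMC

variable {X : Type u} {ℓ : ℕ}

theorem glue_of_lt {i : Fin ℓ} {past : Set.Iio i → X} {x : X} {future : Set.Ioi i → X}
    {j : Fin ℓ} (h : j < i) : glue i past x future j = past ⟨j, h⟩ := by
  simp [glue, h]

theorem glue_self {i : Fin ℓ} {past : Set.Iio i → X} {x : X} {future : Set.Ioi i → X} :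
    glue i past x future i = x := by
  simp [glue]

theorem glue_of_gt {i : Fin ℓ} {past : Set.Iio i → X} {x : X} {future : Set.Ioi i → X}
    {j : Fin ℓ} (h : i < j) : glue i past x future j = future ⟨j, h⟩ := by
  simp [glue, h, h.not_gt]

/-- Splitting a vector into its past, its `i`-th entry and its future. -/
def glueEquiv (i : Fin ℓ) : (Set.Iio i → X) × X × (Set.Ioi i → X) ≃ (Fin ℓ → X) where
  toFun t := glue i t.1 t.2.1 t.2.2
  invFun u := (fun j => u j, u i, fun j => u j)
  left_inv := by
    rintro ⟨p, x, f⟩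
    ext j
    · exact glue_of_lt j.2
    · exact glue_self
    · exact glue_of_gt j.2
  right_inv u := by
    ext j
    rcases lt_trichotomy j i with h | h | h
    · exact glue_of_lt h
    · subst h; exact glue_self
    · exact glue_of_gt h

theorem sum_glue [Fintype X] {M : Type*} [AddCommMonoid M] (i : Fin ℓ) (f : (Fin ℓ → X) → M) :
    ∑ past : Set.Iio i → X, ∑ x, ∑ future : Set.Ioi i → X, f (glue i past x future) =
      ∑ u, f u := by
  rw [← Equiv.sum_comp (glueEquiv i) f, Fintype.sum_prod_type]
  simp only [Fintype.sum_prod_type]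
  rfl

open Classical in
/-- The mass of the vectors which agree with `u` in the first `m` coordinates. -/
noncomputable def prefixMass [Fintype X] (J : (Fin ℓ → X) → ℝ) (m : ℕ) (u : Fin ℓ → X) : ℝ :=
  ∑ v, if ∀ j : Fin ℓ, (j : ℕ) < m → v j = u j then J v else 0

theorem prefixMass_glue [Fintype X] (J : (Fin ℓ → X) → ℝ) (i : Fin ℓ) (past : Set.Iio i → X)
    (x : X) (future : Set.Ioi i → X) :
    prefixMass J i (glue i past x future) = ∑ x', ∑ f : Set.Ioi i → X, J (glue i past x' f) := by
  classical
  unfold prefixMass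
  rw [← sum_glue i, Finset.sum_eq_single past]
  · refine Finset.sum_congr rfl fun x' _ => Finset.sum_congr rfl fun f _ => if_pos fun j hj => ?_
    rw [glue_of_lt hj, glue_of_lt hj]
  · intro p _ hp
    refine Finset.sum_eq_zero fun x' _ => Finset.sum_eq_zero fun f _ => if_neg fun h => hp ?_
    ext j
    have := h j j.2
    rwa [glue_of_lt j.2, glue_of_lt j.2] at this
  · simp

theorem prefixMass_succ_glue [Fintype X] (J : (Fin ℓ → X) → ℝ) (i : Fin ℓ)
    (past : Set.Iio i → X) (x : X) (future : Set.Ioi i → X) :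
    prefixMass J (i + 1) (glue i past x future) = ∑ f : Set.Ioi i → X, J (glue i past x f) := by
  classical
  unfold prefixMass
  rw [← sum_glue i, Finset.sum_eq_single past, Finset.sum_eq_single x]
  · refine Finset.sum_congr rfl fun f _ => if_pos fun j hj => ?_
    rcases (show j ≤ i from Nat.lt_succ_iff.1 hj).eq_or_lt with h | h
    · subst h; rw [glue_self, glue_self]
    · rw [glue_of_lt h, glue_of_lt h]
  · intro x' _ hx
    refine Finset.sum_eq_zero fun f _ => if_neg fun h => hx ?_
    have := h i (Nat.lt_succ_self _)
    rwa [glue_self, glue_self] at this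
  · simp
  · intro p _ hp
    refine Finset.sum_eq_zero fun x' _ => Finset.sum_eq_zero fun f _ => if_neg fun h => hp ?_
    ext j
    have := h j (Nat.lt_succ_of_lt j.2)
    rwa [glue_of_lt j.2, glue_of_lt j.2] at this
  · simp

/-- The chain rule for the entropy of a vector. -/
theorem sum_sum_homEntropy_glue [Fintype X] (J : (Fin ℓ → X) → ℝ) :
    ∑ i : Fin ℓ, ∑ past : Set.Iio i → X,
      homEntropy (fun x => ∑ f : Set.Ioi i → X, J (glue i past x f)) = homEntropy J := by
  -- Each conditional entropy is a difference of consecutive log prefix masses. The sum telescopes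
  -- from prefix length `0`, where the mass is the total, to length `ℓ`, where it is `J u`.
  have step (i : Fin ℓ) : ∑ past : Set.Iio i → X,
      homEntropy (fun x => ∑ f : Set.Ioi i → X, J (glue i past x f)) =
      ∑ u, J u * Real.log (prefixMass J i u) - ∑ u, J u * Real.log (prefixMass J (i + 1) u) := by
    rw [← sum_glue i fun u => J u * Real.log (prefixMass J i u),
      ← sum_glue i fun u => J u * Real.log (prefixMass J (i + 1) u), ← Finset.sum_sub_distrib]
    refine Finset.sum_congr rfl fun past _ => ?_
    simp only [prefixMass_glue, prefixMass_succ_glue, ← Finset.sum_mul, homEntropy,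
      Real.negMulLog, neg_mul, Finset.sum_neg_distrib]
    ring
  simp only [step]
  rw [Fin.sum_univ_eq_sum_range (fun i => ∑ u, J u * Real.log (prefixMass J i u) -
    ∑ u, J u * Real.log (prefixMass J (i + 1) u)) ℓ, Finset.sum_range_sub']
  have h0 (u : Fin ℓ → X) : prefixMass J 0 u = ∑ v, J v := by simp [prefixMass]
  have hl (u : Fin ℓ → X) : prefixMass J ℓ u = J u := by
    classical
    simp [prefixMass, ← funext_iff]
  simp only [h0, hl, ← Finset.sum_mul, homEntropy, Real.negMulLog, neg_mul,
    Finset.sum_neg_distrib]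
  ring

end DMC

theorem hasSum_pi_prod_of_nonneg {Y : Type*} : ∀ (n : ℕ) (f : Fin n → Y → ℝ) (s : Fin n → ℝ),
    (∀ j y, 0 ≤ f j y) → (∀ j, HasSum (f j) (s j)) →
    HasSum (fun y : Fin n → Y => ∏ j, f j (y j)) (∏ j, s j)
  | 0, f, _, _, _ => by
    simp
  | n + 1, f, s, h0, h1 => by
    have ih := hasSum_pi_prod_of_nonneg n (fun j => f j.succ) (fun j => s j.succ)
      (fun j => h0 _) (fun j => h1 _)
    have hs := (h1 0).summable.mul_of_nonneg ih.summable (fun y => h0 0 y)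
      (fun y => Finset.prod_nonneg fun j _ => h0 _ _)
    have h := (h1 0).mul ih hs
    rw [← (Fin.consEquiv fun _ => Y).hasSum_iff]
    simpa [Function.comp_def, Fin.prod_univ_succ, Fin.consEquiv] using h

/-! ### Conditional entropy and posterior correlation of a channel -/

namespace DMC

variable {X : Type u} [Fintype X] {ℓ : ℕ}

/-- The joint probability of the output `y` and a uniformly distributed input `x`. -/
noncomputable def joint (W : DMC X) (y : W.Out) (x : X) : ℝ := 1 / (Fintype.card X : ℝ) * W.prob y x

/-- The probability of the output `y` for a uniformly distributed input. -/
noncomputable def outProb (W : DMC X) (y : W.Out) : ℝ := ∑ x, W.joint y x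

/-- The entropy of a uniformly distributed input given the output, in nats. -/
noncomputable def condEntropy (W : DMC X) : ℝ := ∑' y, homEntropy (W.joint y)

/-- The expected autocorrelation of the posterior distribution of the input. -/
noncomputable def posteriorCorr [Add X] (W : DMC X) (d : X) : ℝ :=
  ∑' y, autocorr (W.joint y) d / W.outProb y

variable (W : DMC X)

theorem joint_nonneg (y : W.Out) (x : X) : 0 ≤ W.joint y x :=
  mul_nonneg (by positivity) (W.prob_nonneg y x)

theorem outProb_nonneg (y : W.Out) : 0 ≤ W.outProb y :=
  Finset.sum_nonneg fun x _ => W.joint_nonneg y x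

theorem hasSum_outProb [Nonempty X] : HasSum W.outProb 1 := by
  have h := hasSum_sum fun x (_ : x ∈ Finset.univ) =>
    (W.hasSum_prob x).mul_left (1 / (Fintype.card X : ℝ))
  have hq : (Fintype.card X : ℝ) ≠ 0 := by exact_mod_cast Fintype.card_ne_zero
  have h1 : ∑ _x : X, 1 / (Fintype.card X : ℝ) * 1 = 1 := by simp [hq]
  rw [h1] at h
  exact h

theorem summable_homEntropy_joint [Nonempty X] : Summable fun y => homEntropy (W.joint y) :=
  .of_nonneg_of_le (fun y => homEntropy_nonneg (W.joint_nonneg y))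
    (fun y => homEntropy_le_card_mul (W.joint_nonneg y))
    (W.hasSum_outProb.summable.mul_left (Fintype.card X : ℝ))

theorem hasSum_condEntropy [Nonempty X] :
    HasSum (fun y => homEntropy (W.joint y)) W.condEntropy :=
  W.summable_homEntropy_joint.hasSum

theorem condEntropy_nonneg : 0 ≤ W.condEntropy :=
  tsum_nonneg fun y => homEntropy_nonneg (W.joint_nonneg y)

theorem condEntropy_le_log_card [Nonempty X] : W.condEntropy ≤ Real.log (Fintype.card X) := by
  have h := hasSum_le (fun y => homEntropy_le_log_card_mul (W.joint_nonneg y))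
    W.hasSum_condEntropy (W.hasSum_outProb.mul_left _)
  simpa using h

theorem symmetricCapacity_eq [Nontrivial X] :
    W.symmetricCapacity = 1 - W.condEntropy / Real.log (Fintype.card X) := by
  have hq1 : (1 : ℝ) < Fintype.card X := by exact_mod_cast Fintype.one_lt_card
  have hq : (0 : ℝ) < Fintype.card X := by positivity
  have hlog : 0 < Real.log (Fintype.card X) := Real.log_pos hq1
  have hterm (x : X) (y : W.Out) : (1 / (Fintype.card X : ℝ)) * W.prob y x *
      Real.logb (Fintype.card X)
        (W.prob y x / ((1 / (Fintype.card X : ℝ)) * ∑ x' : X, W.prob y x')) =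
      W.joint y x - (Real.negMulLog (W.joint y x) + W.joint y x * Real.log (W.outProb y)) /
        Real.log (Fintype.card X) := by
    have h1 : (1 / (Fintype.card X : ℝ)) * ∑ x' : X, W.prob y x' = W.outProb y := by
      unfold outProb joint
      rw [Finset.mul_sum]
    have h2 : W.prob y x = Fintype.card X * W.joint y x := by
      unfold joint
      field_simp
    rw [h1]
    change W.joint y x * _ = _
    rw [h2]
    rcases (W.joint_nonneg y x).eq_or_lt with h | h
    · simp [← h]
    · have hQ : 0 < W.outProb y :=
        h.trans_le (Finset.single_le_sum (fun i _ => W.joint_nonneg y i) (Finset.mem_univ x))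
      unfold Real.logb Real.negMulLog
      rw [Real.log_div (by positivity) hQ.ne', Real.log_mul hq.ne' h.ne']
      field_simp
      ring
  have hsj (x : X) : HasSum (fun y => W.joint y x) (1 / (Fintype.card X : ℝ)) := by
    have h := (W.hasSum_prob x).mul_left (1 / (Fintype.card X : ℝ))
    rw [mul_one] at h
    exact h
  have hse (x : X) : Summable fun y =>
      Real.negMulLog (W.joint y x) + W.joint y x * Real.log (W.outProb y) :=
    .of_nonneg_of_le (fun y => negMulLog_add_mul_log_sum_nonneg (W.joint_nonneg y) x)
      (fun y => negMulLog_add_mul_log_sum_le (W.joint_nonneg y) x) W.hasSum_outProb.summable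
  have hH : W.condEntropy = ∑ x, ∑' y,
      (Real.negMulLog (W.joint y x) + W.joint y x * Real.log (W.outProb y)) := by
    rw [← Summable.tsum_finsetSum fun x _ => hse x]
    exact tsum_congr fun y => homEntropy_eq_sum _
  unfold symmetricCapacity
  simp only [hterm]
  have hx (x : X) := ((hsj x).sub ((hse x).hasSum.div_const (Real.log (Fintype.card X)))).tsum_eq
  simp only [hx, Finset.sum_sub_distrib, ← Finset.sum_div, ← hH]
  simp [hq.ne']

theorem symmetricCapacity_nonneg [Nontrivial X] : 0 ≤ W.symmetricCapacity := by
  rw [symmetricCapacity_eq]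
  have hlog : 0 < Real.log (Fintype.card X) :=
    Real.log_pos (by exact_mod_cast Fintype.one_lt_card)
  have := (div_le_one hlog).2 W.condEntropy_le_log_card
  linarith

theorem symmetricCapacity_le_one [Nontrivial X] : W.symmetricCapacity ≤ 1 := by
  rw [symmetricCapacity_eq]
  have hlog : 0 < Real.log (Fintype.card X) :=
    Real.log_pos (by exact_mod_cast Fintype.one_lt_card)
  have := div_nonneg W.condEntropy_nonneg hlog.le
  linarith

section posteriorCorr

variable [AddGroup X]

theorem autocorr_joint_div_nonneg (d : X) (y : W.Out) :
    0 ≤ autocorr (W.joint y) d / W.outProb y :=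
  div_nonneg (autocorr_nonneg (W.joint_nonneg y) d) (W.outProb_nonneg y)

theorem hasSum_posteriorCorr (d : X) :
    HasSum (fun y => autocorr (W.joint y) d / W.outProb y) (W.posteriorCorr d) := by
  have : Nonempty X := ⟨d⟩
  refine (Summable.of_nonneg_of_le (W.autocorr_joint_div_nonneg d) (fun y => ?_)
    W.hasSum_outProb.summable).hasSum
  exact div_le_of_le_mul₀ (W.outProb_nonneg y) (W.outProb_nonneg y)
    (autocorr_le_sq (W.joint_nonneg y) d)

theorem posteriorCorr_nonneg (d : X) : 0 ≤ W.posteriorCorr d :=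
  tsum_nonneg (W.autocorr_joint_div_nonneg d)

theorem posteriorCorr_le_zero (d : X) : W.posteriorCorr d ≤ W.posteriorCorr 0 :=
  hasSum_le (fun y => div_le_div_of_nonneg_right (autocorr_le_autocorr_zero _ d)
    (W.outProb_nonneg y)) (W.hasSum_posteriorCorr d) (W.hasSum_posteriorCorr 0)

theorem sum_posteriorCorr : ∑ d, W.posteriorCorr d = 1 := by
  have : Nonempty X := ⟨0⟩
  have h := hasSum_sum fun d (_ : d ∈ Finset.univ) => W.hasSum_posteriorCorr d
  refine h.unique (W.hasSum_outProb.congr_fun ?_)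
  intro y
  rw [← Finset.sum_div, sum_autocorr]
  exact mul_self_div_self _

theorem log_card_sub_condEntropy_le :
    Real.log (Fintype.card X) - W.condEntropy ≤ Fintype.card X * W.posteriorCorr 0 - 1 := by
  have : Nonempty X := ⟨0⟩
  have h := hasSum_le (fun y => log_card_mul_sub_homEntropy_le (W.joint_nonneg y))
    ((W.hasSum_outProb.mul_left _).sub W.hasSum_condEntropy)
    (((W.hasSum_posteriorCorr 0).mul_left (Fintype.card X : ℝ)).sub W.hasSum_outProb |>.congr_fun
      fun y => by rw [autocorr_zero_right]; rfl)
  simpa using h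

theorem condEntropy_le_of_pos {η : ℝ} (hη : 0 < η) :
    W.condEntropy ≤ (1 - W.posteriorCorr 0) / η + Fintype.card X * η := by
  have : Nonempty X := ⟨0⟩
  have h := hasSum_le (fun y => homEntropy_le_of_pos (W.joint_nonneg y) hη)
    W.hasSum_condEntropy
    (((W.hasSum_outProb.sub (W.hasSum_posteriorCorr 0)).div_const η).add
      (W.hasSum_outProb.mul_left (Fintype.card X * η)) |>.congr_fun
      fun y => by rw [autocorr_zero_right]; rfl)
  simpa using h

end posteriorCorr

/-! ### Conservation of capacity -/

section subchannel

variable (g : (Fin ℓ → X) → (Fin ℓ → X))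

theorem joint_subchannel (i : Fin ℓ) (y : Fin ℓ → W.Out) (past : Set.Iio i → X) (x : X) :
    (W.subchannel g i).joint (y, past) x =
      ∑ f : Set.Ioi i → X, ∏ j, W.joint (y j) (g (glue i past x f) j) := by
  unfold joint
  simp only [Finset.prod_mul_distrib, Finset.prod_const, ← Finset.mul_sum, Finset.card_univ,
    Fintype.card_fin]
  change _ * (_ * _) = _
  rw [← mul_assoc, one_div_pow, one_div_mul_one_div, ← pow_succ',
    Nat.sub_add_cancel (Nat.one_le_iff_ne_zero.2 (Fin.pos i).ne')]
  rfl

theorem hasSum_condEntropy_subchannel [Nonempty X] (i : Fin ℓ) :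
    HasSum (fun y : Fin ℓ → W.Out => ∑ past : Set.Iio i → X,
      homEntropy fun x => ∑ f : Set.Ioi i → X, ∏ j, W.joint (y j) (g (glue i past x f) j))
      (W.subchannel g i).condEntropy := by
  have h := (W.subchannel g i).hasSum_condEntropy
  have h2 := HasSum.prod_fiberwise (β := Fin ℓ → W.Out) (γ := Set.Iio i → X) h
    fun y => hasSum_fintype _
  refine h2.congr_fun fun y => Finset.sum_congr rfl fun past _ => congrArg _ (funext fun x => ?_)
  rw [joint_subchannel]

/-- A bijective kernel preserves the total capacity. -/
theorem sum_condEntropy_subchannel [Nonempty X] (hg : Function.Bijective g) :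
    ∑ i, (W.subchannel g i).condEntropy = ℓ * W.condEntropy := by
  have h := hasSum_sum fun i (_ : i ∈ Finset.univ) => W.hasSum_condEntropy_subchannel g i
  have h2 (j : Fin ℓ) : HasSum (fun y : Fin ℓ → W.Out => homEntropy (W.joint (y j)) *
      ∏ j' ∈ Finset.univ.erase j, W.outProb (y j')) W.condEntropy := by
    have := hasSum_pi_prod_of_nonneg ℓ
      (Function.update (fun _ => W.outProb) j fun y => homEntropy (W.joint y))
      (Function.update (fun _ => 1) j W.condEntropy)
      (by
        intro j' y
        by_cases hj : j' = j
        · subst hj; simpa using homEntropy_nonneg (W.joint_nonneg y)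
        · simpa [hj] using W.outProb_nonneg y)
      (by
        intro j'
        by_cases hj : j' = j
        · subst hj; simpa using W.hasSum_condEntropy
        · simpa [hj] using W.hasSum_outProb)
    simp only [← Finset.mul_prod_erase Finset.univ _ (Finset.mem_univ j),
      Function.update_self] at this
    convert this using 1
    · refine funext fun y => congrArg _ (Finset.prod_congr rfl fun j' hj' => ?_)
      rw [Function.update_of_ne (Finset.ne_of_mem_erase hj')]
    · rw [Finset.prod_eq_one, mul_one]
      intro j' hj'
      rw [Function.update_of_ne (Finset.ne_of_mem_erase hj')]
  have h3 := hasSum_sum fun j (_ : j ∈ Finset.univ) => h2 j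
  have h4 := h.unique (h3.congr_fun fun y => ?_)
  · simpa using h4
  -- For fixed `y`: additivity over the product, invariance under the bijection `g`, then the chain
  -- rule.
  exact (homEntropy_pi fun j => W.joint (y j)).symm.trans
    ((homEntropy_comp_equiv (Equiv.ofBijective g hg) fun x => ∏ j, W.joint (y j) (x j)).symm.trans
      (sum_sum_homEntropy_glue fun u => ∏ j, W.joint (y j) (g u j)).symm) |>.symm

theorem sum_symmetricCapacity_subchannel [Nontrivial X] (hg : Function.Bijective g) :
    ∑ i, (W.subchannel g i).symmetricCapacity = ℓ * W.symmetricCapacity := by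
  simp only [symmetricCapacity_eq, Finset.sum_sub_distrib, ← Finset.sum_div,
    sum_condEntropy_subchannel W g hg]
  simp
  ring

end subchannel

end DMC

theorem prod_univ_eq_mul_mul_prod_erase {ι M : Type*} [Fintype ι] [DecidableEq ι] [CommMonoid M]
    (f : ι → M) {a b : ι} (hab : a ≠ b) :
    ∏ j, f j = f a * f b * ∏ j ∈ (Finset.univ.erase a).erase b, f j := by
  rw [mul_assoc, Finset.mul_prod_erase _ f (by simp [hab.symm]),
    Finset.mul_prod_erase _ f (Finset.mem_univ a)]

theorem hasSum_pi_pair {Y : Type*} {ℓ : ℕ} {a b : Fin ℓ} (hab : a ≠ b) {N φ ψ : Y → ℝ}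
    {s t : ℝ} (hN : ∀ y, 0 ≤ N y) (hφ : ∀ y, 0 ≤ φ y) (hψ : ∀ y, 0 ≤ ψ y)
    (sN : HasSum N 1) (sφ : HasSum φ s) (sψ : HasSum ψ t) :
    HasSum (fun y : Fin ℓ → Y => φ (y a) * ψ (y b) *
      ∏ j ∈ (Finset.univ.erase a).erase b, N (y j)) (s * t) := by
  have h := hasSum_pi_prod_of_nonneg ℓ
    (fun j => if j = a then φ else if j = b then ψ else N)
    (fun j => if j = a then s else if j = b then t else 1)
    (fun j y => by split_ifs <;> simp [hN, hφ, hψ])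
    (fun j => by split_ifs <;> assumption)
  simp only [prod_univ_eq_mul_mul_prod_erase _ hab, if_true, if_neg hab.symm] at h
  have h1 : ∏ j ∈ (Finset.univ.erase a).erase b,
      (if j = a then s else if j = b then t else 1) = 1 := by
    refine Finset.prod_eq_one fun j hj => ?_
    simp only [Finset.mem_erase] at hj
    rw [if_neg hj.2.1, if_neg hj.1]
  rw [h1, mul_one] at h
  refine h.congr_fun fun y => congrArg _ (Finset.prod_congr rfl fun j hj => ?_)
  simp only [Finset.mem_erase] at hj
  rw [if_neg hj.2.1, if_neg hj.1]

theorem sum_pi_prod_of_two_coords {ι κ : Type*} [Fintype ι] [DecidableEq ι] [Fintype κ]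
    [DecidableEq κ] (w : ι → κ → ℝ) {a b : ι} (hab : a ≠ b) (t s : κ) :
    ∑ x : ι → κ, (if x a = t ∧ x b = s then ∏ j, w j (x j) else 0) =
      w a t * w b s * ∏ j ∈ (Finset.univ.erase a).erase b, ∑ v, w j v := by
  have h := sum_pi_prod fun j v => if (j = a → v = t) ∧ (j = b → v = s) then w j v else 0
  rw [prod_univ_eq_mul_mul_prod_erase _ hab] at h
  convert h using 1
  · refine Finset.sum_congr rfl fun x _ => ?_
    rw [Finset.prod_ite_zero]
    have hiff : (∀ j ∈ Finset.univ, (j = a → x j = t) ∧ (j = b → x j = s)) ↔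
        x a = t ∧ x b = s := by
      refine ⟨fun hx => ⟨(hx a (Finset.mem_univ a)).1 rfl, (hx b (Finset.mem_univ b)).2 rfl⟩,
        fun hx j _ => ⟨?_, ?_⟩⟩
      · rintro rfl; exact hx.1
      · rintro rfl; exact hx.2
    by_cases hx : x a = t ∧ x b = s
    · rw [if_pos hx, if_pos (hiff.2 hx)]
    · rw [if_neg hx, if_neg (mt hiff.1 hx)]
  · congr 1
    · simp [hab, hab.symm]
    · refine Finset.prod_congr rfl fun j hj => ?_
      simp only [Finset.mem_erase] at hj
      simp [hj.1, hj.2.1]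

/-! ### The gain of one subchannel -/

namespace DMC

variable {F : Type u} [Field F] [Fintype F] {ℓ : ℕ}

/-- Replace the input by coordinate `a`, a bijective change for each past, and retain only `s = L₂
past` of the past. Merging pasts with equal `s` can only raise the entropy, and sums all coordinates
other than `a`, `b` freely. -/
theorem sum_homEntropy_glue_le {g : (Fin ℓ → F) → (Fin ℓ → F)} (hg : Function.Bijective g)
    {k a b : Fin ℓ} (hab : a ≠ b) {c α : F} (hc : c ≠ 0) {L₁ L₂ : (Set.Iio k → F) → F}
    (h₁ : ∀ past x f, g (glue k past x f) a = c * x + L₁ past)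
    (h₂ : ∀ past x f, g (glue k past x f) b = L₂ past + α * g (glue k past x f) a)
    {w : Fin ℓ → F → ℝ} (hw : ∀ j x, 0 ≤ w j x) :
    ∑ past : Set.Iio k → F,
      homEntropy (fun x => ∑ f : Set.Ioi k → F, ∏ j, w j (g (glue k past x f) j)) ≤
    (∑ s, homEntropy fun x => w a x * w b (s + α * x)) *
      ∏ j ∈ (Finset.univ.erase a).erase b, ∑ t, w j t := by
  classical
  set J : (Fin ℓ → F) → ℝ := fun u => ∏ j, w j (g u j) with hJ
  have hJ0 (u : Fin ℓ → F) : 0 ≤ J u := Finset.prod_nonneg fun j _ => hw _ _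
  have hre (past : Set.Iio k → F) :
      homEntropy (fun x => ∑ f : Set.Ioi k → F, J (glue k past x f)) =
      homEntropy fun t => ∑ f : Set.Ioi k → F, J (glue k past (c⁻¹ * (t - L₁ past)) f) :=
    (homEntropy_comp_equiv ((Equiv.subRight (L₁ past)).trans (Equiv.mulLeft₀ c⁻¹ (inv_ne_zero hc)))
      fun x => ∑ f : Set.Ioi k → F, J (glue k past x f)).symm
  have hmarg (s t : F) : ∑ past : Set.Iio k → F with L₂ past = s,
      ∑ f : Set.Ioi k → F, J (glue k past (c⁻¹ * (t - L₁ past)) f) =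
      (∏ j ∈ (Finset.univ.erase a).erase b, ∑ v, w j v) * (w a t * w b (s + α * t)) := by
    rw [mul_comm, ← sum_pi_prod_of_two_coords w hab,
      ← Equiv.sum_comp (Equiv.ofBijective g hg), ← sum_glue k, Finset.sum_filter]
    refine Finset.sum_congr rfl fun past _ => ?_
    simp only [Equiv.ofBijective_apply, h₂, h₁]
    rw [Finset.sum_eq_single (c⁻¹ * (t - L₁ past))]
    · have : c * (c⁻¹ * (t - L₁ past)) + L₁ past = t := by field_simp; ring
      simp only [this, true_and, add_left_inj]
      split_ifs <;> simp [hJ]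
    · intro x _ hx
      refine Finset.sum_eq_zero fun f _ => if_neg fun h => hx ?_
      rw [← h.1]
      field_simp
      ring
    · simp
  change ∑ past : Set.Iio k → F, homEntropy (fun x => ∑ f : Set.Ioi k → F, J (glue k past x f)) ≤ _
  simp only [hre]
  rw [← Finset.sum_fiberwise Finset.univ L₂, Finset.sum_mul]
  refine Finset.sum_le_sum fun s _ => ?_
  refine (sum_homEntropy_le _ fun past t => Finset.sum_nonneg fun f _ => hJ0 _).trans_eq ?_
  simp only [hmarg, homEntropy_mul]
  exact mul_comm _ _

/-- Sum the pointwise bound over `y`. The outputs at `a` and `b` occur in separate factors, so each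
product of autocorrelations sums to a product of values of `posteriorCorr`. -/
theorem condEntropy_subchannel_le (W : DMC F) {g : (Fin ℓ → F) → (Fin ℓ → F)}
    (hg : Function.Bijective g)
    {k a b : Fin ℓ} (hab : a ≠ b) {c α : F} (hc : c ≠ 0) {L₁ L₂ : (Set.Iio k → F) → F}
    (h₁ : ∀ past x f, g (glue k past x f) a = c * x + L₁ past)
    (h₂ : ∀ past x f, g (glue k past x f) b = L₂ past + α * g (glue k past x f) a) :
    (W.subchannel g k).condEntropy ≤ W.condEntropy -
      1 / 4 * (W.posteriorCorr 0 - ∑ d, W.posteriorCorr d * W.posteriorCorr (α * d)) := by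
  have hle (y : Fin ℓ → W.Out) := (sum_homEntropy_glue_le hg hab hc h₁ h₂ fun j x =>
    W.joint_nonneg (y j) x).trans (mul_le_mul_of_nonneg_right
      (sum_homEntropy_shear_le (W.joint_nonneg (y a)) (W.joint_nonneg (y b)) α)
      (Finset.prod_nonneg fun j _ => W.outProb_nonneg (y j)))
  have hH := hasSum_pi_pair hab W.outProb_nonneg
    (fun y => homEntropy_nonneg (W.joint_nonneg y)) W.outProb_nonneg W.hasSum_outProb
    W.hasSum_condEntropy W.hasSum_outProb
  have h0 := hasSum_pi_pair hab W.outProb_nonneg W.outProb_nonneg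
    (W.autocorr_joint_div_nonneg 0) W.hasSum_outProb W.hasSum_outProb (W.hasSum_posteriorCorr 0)
  have hd := hasSum_sum fun d (_ : d ∈ Finset.univ) => hasSum_pi_pair hab W.outProb_nonneg
    (W.autocorr_joint_div_nonneg d) (W.autocorr_joint_div_nonneg (α * d)) W.hasSum_outProb
    (W.hasSum_posteriorCorr d) (W.hasSum_posteriorCorr (α * d))
  have h := hasSum_le hle (W.hasSum_condEntropy_subchannel g k)
    ((hH.sub ((h0.sub hd).mul_left (1 / 4))).congr_fun fun y => ?_)
  · simpa using h
  · rw [← Finset.sum_mul, sub_mul, mul_assoc (1 / 4 : ℝ), sub_mul]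
    rfl

theorem corr_dichotomy {M : F → ℝ} (hM : ∀ d, 0 ≤ M d) (hM0 : ∀ d, M d ≤ M 0)
    (hM1 : ∑ d, M d = 1) {α : F} (hα : IsPrimitiveRoot α (Fintype.card F - 1)) {θ : ℝ}
    (hθ : 0 < θ) (hθq : 2 * θ ≤ 1 / Fintype.card F)
    (h : M 0 - ∑ d, M d * M (α * d) < θ ^ 2) :
    Fintype.card F * M 0 ≤ 1 + Fintype.card F * θ ∨ 1 - M 0 ≤ Fintype.card F * θ := by
  classical
  have hq : (0 : ℝ) < Fintype.card F := by exact_mod_cast Fintype.card_pos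
  have hα0 : α ≠ 0 := by
    refine hα.ne_zero ?_
    have := Fintype.one_lt_card (α := F)
    omega
  have hsum : ∑ d, M d * (M 0 - M (α * d)) = M 0 - ∑ d, M d * M (α * d) := by
    simp only [mul_sub, Finset.sum_sub_distrib, ← Finset.sum_mul, hM1, one_mul]
  have hterm (d : F) : M d * (M 0 - M (α * d)) < θ ^ 2 := by
    refine lt_of_le_of_lt ?_ (hsum.trans_lt h)
    exact Finset.single_le_sum (f := fun d => M d * (M 0 - M (α * d)))
      (fun i _ => mul_nonneg (hM i) (sub_nonneg.2 (hM0 _))) (Finset.mem_univ d)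
  have hM0q : 1 / (Fintype.card F : ℝ) ≤ M 0 := by
    rw [div_le_iff₀ hq, ← hM1]
    refine (Finset.sum_le_sum fun d _ => hM0 d).trans_eq ?_
    simp [mul_comm]
  -- A product below `θ ^ 2` with one factor at least `θ` has the other below `θ`. Since `2 * θ ≤ 1
  -- / q ≤ M 0`, the conclusion again exceeds `θ`, so the step iterates without accumulating loss.
  have hnear (d : F) (hd : θ ≤ M d) : M 0 - θ ≤ M (α * d) := by
    by_contra! hlt
    have := hterm d
    nlinarith
  by_cases hex : ∃ d, d ≠ 0 ∧ θ ≤ M d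
  · obtain ⟨d, hd0, hd⟩ := hex
    have horbit (n : ℕ) : θ ≤ M (α ^ n * d) := by
      induction n with
      | zero => simpa using hd
      | succ n ih =>
        have := hnear _ ih
        rw [pow_succ', mul_assoc]
        linarith
    have hall (e : F) : M 0 - θ ≤ M e := by
      by_cases he : e = 0
      · rw [he]; linarith
      · have hpow : (α⁻¹ * e / d) ^ (Fintype.card F - 1) = 1 :=
          FiniteField.pow_card_sub_one_eq_one _ (by positivity)
        have : NeZero (Fintype.card F - 1) :=
          ⟨by have := Fintype.one_lt_card (α := F); omega⟩
        obtain ⟨n, -, hn⟩ := hα.eq_pow_of_pow_eq_one hpow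
        have h1 := hnear _ (horbit n)
        rwa [hn, div_mul_cancel₀ _ hd0, mul_inv_cancel_left₀ hα0] at h1
    left
    have h2 := Finset.sum_le_sum fun e (_ : e ∈ Finset.univ) => hall e
    rw [hM1] at h2
    simp at h2
    linarith
  · push Not at hex
    right
    have h2 : ∑ d, M d ≤ ∑ d : F, (θ + if d = 0 then M 0 else 0) := by
      refine Finset.sum_le_sum fun d _ => ?_
      by_cases hd : d = 0
      · simp [hd, hθ.le]
      · simpa [hd] using (hex d hd).le
    rw [hM1, Finset.sum_add_distrib] at h2
    simp at h2
    linarith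

theorem posteriorCorr_gap_nonneg (W : DMC F) (α : F) :
    0 ≤ W.posteriorCorr 0 - ∑ d, W.posteriorCorr d * W.posteriorCorr (α * d) := by
  have h : ∑ d, W.posteriorCorr d * W.posteriorCorr (α * d) ≤
      ∑ d, W.posteriorCorr d * W.posteriorCorr 0 :=
    Finset.sum_le_sum fun d _ => mul_le_mul_of_nonneg_left (W.posteriorCorr_le_zero _)
      (W.posteriorCorr_nonneg d)
  rw [← Finset.sum_mul, W.sum_posteriorCorr, one_mul] at h
  linarith

theorem exists_posteriorCorr_gap {α : F} (hα : IsPrimitiveRoot α (Fintype.card F - 1)) {ε : ℝ}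
    (hε : 0 < ε) : ∃ δ > 0, ∀ W : DMC F, ε < W.symmetricCapacity → W.symmetricCapacity < 1 - ε →
      δ ≤ W.posteriorCorr 0 - ∑ d, W.posteriorCorr d * W.posteriorCorr (α * d) := by
  have hq1 : (1 : ℝ) < Fintype.card F := by exact_mod_cast Fintype.one_lt_card
  set q : ℝ := (Fintype.card F : ℝ) with hqdef
  have hq : 0 < q := by positivity
  have hL : 0 < Real.log q := Real.log_pos hq1
  set L := Real.log q with hLdef
  -- `η` makes the slack `q * η` half of `ε * L`. The three bounds on `θ` serve the dichotomy, the
  -- nearly uniform case, and the other half of `ε * L` in the concentrated case.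
  set η : ℝ := ε * L / (2 * q) with hη
  have hη0 : 0 < η := by positivity
  set θ : ℝ := min (1 / (2 * q)) (min (ε * L / q) (η * (ε * L) / (2 * q))) with hθ
  have hθ0 : 0 < θ := by positivity
  have hθ1 : θ ≤ 1 / (2 * q) := min_le_left _ _
  have hθ2 : θ ≤ ε * L / q := (min_le_right _ _).trans (min_le_left _ _)
  have hθ3 : θ ≤ η * (ε * L) / (2 * q) := (min_le_right _ _).trans (min_le_right _ _)
  refine ⟨θ ^ 2, by positivity, fun W hW1 hW2 => ?_⟩
  by_contra! hlt
  rw [symmetricCapacity_eq, ← hqdef, ← hLdef] at hW1 hW2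
  have hW1' : W.condEntropy < L - ε * L := by
    have : W.condEntropy / L < 1 - ε := by linarith
    rw [div_lt_iff₀ hL] at this
    linarith
  have hW2' : ε * L < W.condEntropy := by
    have : ε < W.condEntropy / L := by linarith
    rwa [lt_div_iff₀ hL] at this
  rcases corr_dichotomy W.posteriorCorr_nonneg W.posteriorCorr_le_zero W.sum_posteriorCorr hα hθ0
    (by
      rw [← hqdef]
      calc 2 * θ ≤ 2 * (1 / (2 * q)) := by linarith
        _ = 1 / q := by field_simp) hlt with h | h
  · have h1 := W.log_card_sub_condEntropy_le
    rw [← hqdef] at h h1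
    have h2 : q * θ ≤ ε * L := by
      rw [le_div_iff₀ hq] at hθ2
      linarith
    linarith
  · have h1 := W.condEntropy_le_of_pos hη0
    rw [← hqdef] at h h1
    have h2 : (1 - W.posteriorCorr 0) / η ≤ ε * L / 2 := by
      rw [div_le_iff₀ hη0]
      rw [le_div_iff₀ (by positivity)] at hθ3
      linarith
    have h3 : q * η = ε * L / 2 := by
      rw [hη]
      field_simp
    linarith

/-- A kernel one of whose subchannels contains a shear with a primitive coefficient strictly
increases the capacity of that subchannel, uniformly away from the extremal channels. -/
theorem exists_symmetricCapacity_gap {g : (Fin ℓ → F) → (Fin ℓ → F)} (hg : Function.Bijective g)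
    {k a b : Fin ℓ} (hab : a ≠ b) {c α : F} (hc : c ≠ 0) {L₁ L₂ : (Set.Iio k → F) → F}
    (h₁ : ∀ past x f, g (glue k past x f) a = c * x + L₁ past)
    (h₂ : ∀ past x f, g (glue k past x f) b = L₂ past + α * g (glue k past x f) a)
    (hα : IsPrimitiveRoot α (Fintype.card F - 1)) :
    (∀ W : DMC F, W.symmetricCapacity ≤ (W.subchannel g k).symmetricCapacity) ∧
    ∀ ε > 0, ∃ δ > 0, ∀ W : DMC F, ε < W.symmetricCapacity → W.symmetricCapacity < 1 - ε →
      W.symmetricCapacity + δ ≤ (W.subchannel g k).symmetricCapacity := by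
  have hL : 0 < Real.log (Fintype.card F) :=
    Real.log_pos (by exact_mod_cast Fintype.one_lt_card)
  have key (W : DMC F) {δ : ℝ}
      (hδ : δ ≤ W.posteriorCorr 0 - ∑ d, W.posteriorCorr d * W.posteriorCorr (α * d)) :
      W.symmetricCapacity + δ / (4 * Real.log (Fintype.card F)) ≤
        (W.subchannel g k).symmetricCapacity := by
    have h := W.condEntropy_subchannel_le hg hab hc h₁ h₂
    have h' : (W.subchannel g k).condEntropy ≤ W.condEntropy - 1 / 4 * δ := by linarith
    have h2 := div_le_div_of_nonneg_right h' hL.le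
    rw [symmetricCapacity_eq, symmetricCapacity_eq]
    have : (W.condEntropy - 1 / 4 * δ) / Real.log (Fintype.card F) =
      W.condEntropy / Real.log (Fintype.card F) - δ / (4 * Real.log (Fintype.card F)) := by
      field_simp
    linarith
  refine ⟨fun W => ?_, fun ε hε => ?_⟩
  · simpa using key W (W.posteriorCorr_gap_nonneg α)
  · obtain ⟨δ, hδ, h⟩ := exists_posteriorCorr_gap hα hε
    exact ⟨δ / (4 * Real.log (Fintype.card F)), by positivity, fun W h1 h2 => key W (h W h1 h2)⟩

end DMC

/-! ### Almost sure polarization of a bounded martingale -/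

section polarization

variable {ι S : Type*} {Ω : Type*} [mΩ : MeasurableSpace Ω]

/-- The state reached from `s` after the first `n` of the random moves `b`. -/
def iterState (step : S → ι → S) (s : S) (b : ℕ → ι) : ℕ → S
  | 0 => s
  | n + 1 => step (iterState step s b n) (b n)

theorem iterState_congr (step : S → ι → S) (s : S) {b b' : ℕ → ι} :
    ∀ {n : ℕ}, (∀ m < n, b m = b' m) → iterState step s b n = iterState step s b' n
  | 0, _ => rfl
  | n + 1, h => by
    simp only [iterState]
    rw [iterState_congr step s fun m hm => h m (Nat.lt_succ_of_lt hm), h n n.lt_succ_self]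

variable [MeasurableSpace ι]

/-- The filtration whose `n`-th member is generated by `B 0, …, B n`. -/
def movesFiltration {B : ℕ → Ω → ι} (hB : ∀ n, Measurable (B n)) : Filtration ℕ mΩ where
  seq n := ⨆ m ∈ {m | m ≤ n}, MeasurableSpace.comap (B m) inferInstance
  mono' _ _ hij := biSup_mono fun _ hm => le_trans hm hij
  le' _ := iSup₂_le fun m _ => (hB m).comap_le

theorem measurable_movesFiltration {B : ℕ → Ω → ι} (hB : ∀ n, Measurable (B n)) {m n : ℕ}
    (hmn : m ≤ n) : Measurable[movesFiltration hB n] (B m) :=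
  (comap_measurable (B m)).mono
    (le_iSup₂_of_le (f := fun m (_ : m ∈ {m | m ≤ n}) =>
      MeasurableSpace.comap (B m) inferInstance) m hmn le_rfl) le_rfl

theorem indep_movesFiltration {P : Measure Ω} {B : ℕ → Ω → ι} (hB : ∀ n, Measurable (B n))
    (hindep : iIndepFun B P) (n : ℕ) :
    Indep (MeasurableSpace.comap (B (n + 1)) inferInstance) (movesFiltration hB n) P := by
  have := indep_iSup_of_disjoint (S := {n + 1}) (T := {m | m ≤ n})
    (fun k => (hB k).comap_le) hindep (by simp)
  rwa [iSup_singleton] at this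

variable [MeasurableSingletonClass ι]

/-- The state space carries no σ-algebra; measurability comes from factoring through the finite set
of move sequences. The filler `i₀` is never read. -/
theorem stronglyMeasurable_iterState [Finite ι] [Nonempty ι] {B : ℕ → Ω → ι} (hB : ∀ n, Measurable (B n))
    (step : S → ι → S) (s : S) (Φ : S → ℝ) (n : ℕ) :
    StronglyMeasurable[movesFiltration hB n]
      fun ω => Φ (iterState step s (fun m => B m ω) (n + 1)) := by
  classical
  have i₀ : ι := Classical.arbitrary ι
  have htuple : Measurable[movesFiltration hB n] fun ω (m : Fin (n + 1)) => B m ω :=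
    @measurable_pi_lambda _ _ _ (movesFiltration hB n) _ _ fun m =>
      measurable_movesFiltration hB (Nat.lt_succ_iff.1 m.2)
  have hψ : Measurable fun t : Fin (n + 1) → ι =>
      Φ (iterState step s (fun m => if h : m < n + 1 then t ⟨m, h⟩ else i₀) (n + 1)) :=
    measurable_of_finite _
  have := (hψ.comp htuple).stronglyMeasurable
  convert this using 2 with ω
  refine congrArg Φ (iterState_congr step s fun m hm => ?_)
  simp [hm]

/-- The known factor `φ` comes out of the conditional expectation, and the next move is independent
of the past. -/
theorem condExp_mul_indicator {P : Measure Ω} [IsProbabilityMeasure P] {B : ℕ → Ω → ι}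
    (hB : ∀ n, Measurable (B n)) (hindep : iIndepFun B P) {n : ℕ} {φ : Ω → ℝ}
    (hφ : StronglyMeasurable[movesFiltration hB n] φ) {C : ℝ} (hC : ∀ ω, |φ ω| ≤ C) (i : ι) :
    Integrable (φ * {ω | B (n + 1) ω = i}.indicator fun _ => (1 : ℝ)) P ∧
    P[φ * {ω | B (n + 1) ω = i}.indicator (fun _ => (1 : ℝ)) | movesFiltration hB n] =ᵐ[P]
      fun ω => φ ω * P.real {ω | B (n + 1) ω = i} := by
  have hle := (movesFiltration hB).le n
  have hset : MeasurableSet {ω | B (n + 1) ω = i} := hB (n + 1) (measurableSet_singleton i)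
  have hg : Integrable ({ω | B (n + 1) ω = i}.indicator fun _ => (1 : ℝ)) P :=
    (integrable_const 1).indicator hset
  have hfg : Integrable (φ * {ω | B (n + 1) ω = i}.indicator fun _ => (1 : ℝ)) P :=
    hg.bdd_mul (hφ.mono hle).aestronglyMeasurable (ae_of_all _ hC)
  refine ⟨hfg, (condExp_mul_of_stronglyMeasurable_left hφ hfg hg).trans ?_⟩
  have hsm : StronglyMeasurable[MeasurableSpace.comap (B (n + 1)) inferInstance]
      ({ω | B (n + 1) ω = i}.indicator fun _ => (1 : ℝ)) :=
    stronglyMeasurable_const.indicator ⟨{i}, measurableSet_singleton i, rfl⟩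
  filter_upwards [condExp_indep_eq (hB (n + 1)).comap_le hle hsm
    (indep_movesFiltration hB hindep n)] with ω hω
  rw [Pi.mul_apply, hω]
  exact congrArg (φ ω * ·) (integral_indicator_one hset)

variable [Fintype ι]

/-- A bounded harmonic function of the states of a random walk with uniformly distributed moves
converges almost surely. If one of the moves increases it by an amount bounded below away from the
values `0` and `1`, then the limit is one of these values. -/
theorem exists_limit_mem_zero_one {P : Measure Ω} [IsProbabilityMeasure P] {B : ℕ → Ω → ι}
    (hB : ∀ n, Measurable (B n)) (hindep : iIndepFun B P)
    (hunif : ∀ n i, P.real {ω | B n ω = i} = 1 / (Fintype.card ι : ℝ))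
    {step : S → ι → S} (s : S) {v : S → ℝ} (hv0 : ∀ s, 0 ≤ v s) (hv1 : ∀ s, v s ≤ 1)
    (hsum : ∀ s, ∑ i, v (step s i) = Fintype.card ι * v s) {k : ι}
    (hk : ∀ s, v s ≤ v (step s k))
    (hgap : ∀ ε > 0, ∃ δ > 0, ∀ s, ε < v s → v s < 1 - ε → v s + δ ≤ v (step s k)) :
    ∃ L : Ω → ℝ, Measurable L ∧
      (∀ᵐ ω ∂P, Tendsto (fun n => v (iterState step s (fun m => B m ω) (n + 1))) atTop
        (𝓝 (L ω))) ∧ ∀ᵐ ω ∂P, L ω = 0 ∨ L ω = 1 := by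
  classical
  have : Nonempty ι := ⟨k⟩
  have hcard : (0 : ℝ) < Fintype.card ι := by exact_mod_cast Fintype.card_pos
  set ℱ := movesFiltration hB with hℱ
  -- `Z n` has used the moves `B 0, …, B n`, exactly those generating `ℱ n`; the next move is `B (n
  -- + 1)`.
  set Z : ℕ → Ω → S := fun n ω => iterState step s (fun m => B m ω) (n + 1) with hZ
  have hZs (n : ℕ) (ω : Ω) : Z (n + 1) ω = step (Z n ω) (B (n + 1) ω) := rfl
  set X : ℕ → Ω → ℝ := fun n ω => v (Z n ω) with hX
  have hmeas (Φ : S → ℝ) (n : ℕ) : StronglyMeasurable[ℱ n] fun ω => Φ (Z n ω) :=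
    stronglyMeasurable_iterState hB step s Φ n
  have habs (s : S) : |v s| ≤ 1 := abs_le.2 ⟨by linarith [hv0 s], hv1 s⟩
  have hint (Φ : S → ℝ) {C : ℝ} (hC : ∀ s, |Φ s| ≤ C) (n : ℕ) :
      Integrable (fun ω => Φ (Z n ω)) P :=
    Integrable.of_bound ((hmeas Φ n).mono (ℱ.le n)).aestronglyMeasurable C
      (ae_of_all _ fun ω => hC _)
  have hmart : Martingale X ℱ P := by
    refine martingale_nat (hmeas v) (hint v habs) fun n => ?_
    have hdec : X (n + 1) = ∑ i, (fun ω => v (step (Z n ω) i)) *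
        {ω | B (n + 1) ω = i}.indicator (fun _ => (1 : ℝ)) := by
      ext ω
      simp only [hX, hZs, Finset.sum_apply, Pi.mul_apply, Set.indicator_apply, Set.mem_ofPred_eq]
      simp
    have hc (i : ι) := condExp_mul_indicator hB hindep (hmeas (fun s => v (step s i)) n)
      (fun ω => habs _) i
    rw [hdec]
    have hall := eventually_countable_forall.2 fun i => (hc i).2
    filter_upwards [condExp_finsetSum (s := Finset.univ) (fun i _ => (hc i).1) (ℱ n), hall]
      with ω h1 h2
    rw [h1, Finset.sum_apply]
    simp only [hℱ, h2, hunif, ← Finset.sum_mul, hsum]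
    simp only [hX]
    field_simp
  have hbdd (n : ℕ) : eLpNorm (X n) 1 P ≤ (1 : NNReal) := by
    refine (eLpNorm_le_of_ae_bound (C := 1) (ae_of_all _ fun ω => habs _)).trans ?_
    simp
  obtain ⟨L, hLm, hlim⟩ := measurable_limit_of_tendsto_metrizable_ae
    (fun n => (hmart.integrable n).aestronglyMeasurable.aemeasurable)
    (hmart.submartingale.exists_ae_tendsto_of_bdd hbdd)
  refine ⟨L, hLm, hlim, ?_⟩
  -- the expected increment of the distinguished move tends to zero
  have hD : Tendsto (fun n => ∫ ω, v (step (Z n ω) k) - v (Z n ω) ∂P) atTop (𝓝 0) := by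
    have hstep (n : ℕ) : ∫ ω, ((fun ω => v (step (Z n ω) k) - v (Z n ω)) *
        {ω | B (n + 1) ω = k}.indicator (fun _ => (1 : ℝ))) ω ∂P =
        (∫ ω, v (step (Z n ω) k) - v (Z n ω) ∂P) * (1 / Fintype.card ι) := by
      have hc := condExp_mul_indicator hB hindep
        (hmeas (fun s => v (step s k) - v s) n) (C := 2)
        (fun ω => (abs_sub _ _).trans (by linarith [habs (step (Z n ω) k), habs (Z n ω)])) k
      rw [← integral_condExp (ℱ.le n), integral_congr_ae hc.2, hunif, integral_mul_const]
    have h0 : Tendsto (fun n => ∫ ω, ((fun ω => v (step (Z n ω) k) - v (Z n ω)) *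
        {ω | B (n + 1) ω = k}.indicator (fun _ => (1 : ℝ))) ω ∂P) atTop (𝓝 (∫ _, 0 ∂P)) := by
      -- On the event that move `k` is chosen, its gain is the actual martingale increment, which
      -- tends to zero almost surely and is bounded by `1`.
      have heq (n : ℕ) (ω : Ω) : ((fun ω => v (step (Z n ω) k) - v (Z n ω)) *
          {ω | B (n + 1) ω = k}.indicator (fun _ => (1 : ℝ))) ω =
          (X (n + 1) ω - X n ω) * {ω | B (n + 1) ω = k}.indicator (fun _ => (1 : ℝ)) ω := by
        by_cases h : B (n + 1) ω = k
        · simp [hX, hZs, h]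
        · simp [h]
      have hle (n : ℕ) (ω : Ω) : |(X (n + 1) ω - X n ω) *
          {ω | B (n + 1) ω = k}.indicator (fun _ => (1 : ℝ)) ω| ≤ |X (n + 1) ω - X n ω| := by
        by_cases h : B (n + 1) ω = k <;> simp [h]
      simp only [heq]
      refine tendsto_integral_of_dominated_convergence (fun _ => 1) (fun n => ?_)
        (integrable_const 1) (fun n => ae_of_all _ fun ω => ?_) ?_
      · refine ((((hmart.integrable (n + 1)).sub (hmart.integrable n)).aestronglyMeasurable).mul ?_)
        exact (stronglyMeasurable_const.indicator
          (hB (n + 1) (measurableSet_singleton k))).aestronglyMeasurable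
      · refine (hle n ω).trans (abs_le.2 ⟨?_, ?_⟩)
        · linarith [hv0 (Z (n + 1) ω), hv1 (Z n ω)]
        · linarith [hv0 (Z n ω), hv1 (Z (n + 1) ω)]
      · filter_upwards [hlim] with ω hω
        refine squeeze_zero_norm (fun n => hle n ω) ?_
        have := ((hω.comp (tendsto_add_atTop_nat 1)).sub hω).abs
        simpa using this
    have h1 := h0.mul_const (Fintype.card ι : ℝ)
    simp only [hstep, integral_zero, zero_mul] at h1
    refine h1.congr fun n => ?_
    field_simp
  have hbump (ε : ℝ) (hε : 0 < ε) : ∀ᵐ ω ∂P, ¬ (ε < L ω ∧ L ω < 1 - ε) := by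
    obtain ⟨δ, hδ, hg⟩ := hgap ε hε
    -- A continuous bump, positive exactly on `(ε, 1 - ε)`. Its mean along `X n` is at most `δ⁻¹`
    -- times the expected gain of move `k`, while continuity carries it to the limit `L`.
    set χ : ℝ → ℝ := fun x => max 0 (min 1 (min (x - ε) (1 - ε - x))) with hχ
    have hχc : Continuous χ := by fun_prop
    have hχ0 (x : ℝ) : 0 ≤ χ x := le_max_left _ _
    have hχ1 (x : ℝ) : χ x ≤ 1 := max_le zero_le_one (min_le_left _ _)
    have hχabs (x : ℝ) : |χ x| ≤ 1 := abs_le.2 ⟨by linarith [hχ0 x], hχ1 x⟩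
    have hdom (s : S) : χ (v s) ≤ δ⁻¹ * (v (step s k) - v s) := by
      by_cases h : ε < v s ∧ v s < 1 - ε
      · refine (hχ1 _).trans ?_
        rw [← inv_mul_cancel₀ hδ.ne']
        exact mul_le_mul_of_nonneg_left (by linarith [hg s h.1 h.2]) (inv_nonneg.2 hδ.le)
      · have : χ (v s) = 0 := by
          refine max_eq_left ((min_le_right _ _).trans ?_)
          by_contra! hlt
          rw [lt_min_iff] at hlt
          exact h ⟨by linarith, by linarith⟩
        rw [this]
        exact mul_nonneg (inv_nonneg.2 hδ.le) (by linarith [hk s])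
    have hup : Tendsto (fun n => ∫ ω, χ (X n ω) ∂P) atTop (𝓝 0) := by
      have h1 := hD.const_mul δ⁻¹
      rw [mul_zero] at h1
      refine squeeze_zero (fun n => integral_nonneg fun ω => hχ0 _) (fun n => ?_) h1
      rw [← integral_const_mul]
      refine integral_mono (hint (fun s => χ (v s)) (fun s => hχabs _) n) ?_ fun ω => hdom _
      exact ((hint (fun s => v (step s k)) (fun s => habs _) n).sub (hint v habs n)).const_mul _
    have hlimχ : Tendsto (fun n => ∫ ω, χ (X n ω) ∂P) atTop (𝓝 (∫ ω, χ (L ω) ∂P)) := by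
      refine tendsto_integral_of_dominated_convergence (fun _ => 1)
        (fun n => (hint (fun s => χ (v s)) (fun s => hχabs _) n).aestronglyMeasurable)
        (integrable_const 1) (fun n => ae_of_all _ fun ω => hχabs _) ?_
      filter_upwards [hlim] with ω hω
      exact (hχc.tendsto _).comp hω
    have hzero := tendsto_nhds_unique hlimχ hup
    have hintL : Integrable (fun ω => χ (L ω)) P :=
      Integrable.of_bound (hχc.measurable.comp hLm).aestronglyMeasurable 1
        (ae_of_all _ fun ω => hχabs _)
    have hae := (integral_eq_zero_iff_of_nonneg (fun ω => hχ0 _) hintL).1 hzero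
    filter_upwards [hae] with ω hω h
    have : 0 < χ (L ω) := lt_max_of_lt_right
      (lt_min one_pos (lt_min (by linarith [h.1]) (by linarith [h.2])))
    exact this.ne' hω
  have hball := ae_all_iff.2 fun n : ℕ => hbump (1 / ((n : ℝ) + 1)) (by positivity)
  filter_upwards [hball, hlim] with ω hω hconv
  have hL0 : 0 ≤ L ω := ge_of_tendsto' hconv fun n => hv0 _
  have hL1 : L ω ≤ 1 := le_of_tendsto' hconv fun n => hv1 _
  by_contra! hne
  have hpos : 0 < min (L ω) (1 - L ω) :=
    lt_min (hL0.lt_of_ne hne.1.symm) (sub_pos.2 (hL1.lt_of_ne hne.2))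
  obtain ⟨n, hn⟩ := exists_nat_one_div_lt hpos
  rw [lt_min_iff] at hn
  exact hω n ⟨hn.1, by linarith [hn.2]⟩

end polarization

/-! ### The shear in a normal form, and the theorem -/

namespace DMC

variable {F : Type u} {ℓ : ℕ}

/-- The last row of a normal form with more than one non-zero entry exhibits a shear. -/
theorem exists_shear_of_normal_form [Field F] (g : (Fin ℓ → F) ≃ₗ[F] (Fin ℓ → F))
    {A : Matrix (Fin ℓ) (Fin ℓ) F} (hA : ∀ v, g v = Matrix.vecMul v A)
    {V : Matrix (Fin ℓ) (Fin ℓ) F} (hV : IsUnit V) (hVupper : ∀ i j, j < i → V i j = 0)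
    (π : Equiv.Perm (Fin ℓ))
    {G : Matrix (Fin ℓ) (Fin ℓ) F} (hG : G = (V * A).submatrix id π)
    (hGlower : ∀ i j, i < j → G i j = 0) {k : Fin ℓ}
    (hk : k ∈ upperBounds {i : Fin ℓ | 1 < {j : Fin ℓ | G i j ≠ 0}.ncard})
    (hkk : G k k = 1) {j : Fin ℓ} (hj : j < k) :
    ∃ c : F, c ≠ 0 ∧ ∃ L₁ L₂ : (Set.Iio k → F) → F,
      (∀ past x f, g (glue k past x f) (π k) = c * x + L₁ past) ∧
      ∀ past x f, g (glue k past x f) (π j) = L₂ past + G k j * g (glue k past x f) (π k) := by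
  have hAunit : IsUnit A := by
    rw [← Matrix.vecMul_injective_iff_isUnit]
    intro v w hvw
    exact g.injective (by rw [hA, hA]; exact hvw)
  have hGunit : IsUnit G := by
    rw [hG]
    exact (Matrix.isUnit_submatrix_equiv (Equiv.refl _) π).2 (hV.mul hAunit)
  have hdiag (i : Fin ℓ) : G i i ≠ 0 := by
    have h := (Matrix.isUnit_iff_isUnit_det G).1 hGunit
    rw [Matrix.det_of_isLowerTriangular G fun i j hij => hGlower i j hij] at h
    exact Finset.prod_ne_zero_iff.1 h.ne_zero i (Finset.mem_univ i)
  -- Below row `k` each row has at most one nonzero entry, and the diagonal one is nonzero by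
  -- invertibility.
  have hrow (i m : Fin ℓ) (hi : k < i) (hm : m ≠ i) : G i m = 0 := by
    by_contra hne
    refine (hk (show i ∈ _ from ?_)).not_gt hi
    exact (Set.one_lt_ncard_iff (Set.toFinite _)).2 ⟨m, i, hne, hdiag i, hm⟩
  obtain ⟨_⟩ := hV.nonempty_invertible
  have hVinv (m i : Fin ℓ) (h : i < m) : V⁻¹ m i = 0 :=
    Matrix.blockTriangular_inv_of_blockTriangular (M := V) (b := id)
      (fun i j hij => hVupper i j hij) h
  have hVdet := (Matrix.isUnit_iff_isUnit_det V).1 hV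
  have hVVinv : V * V⁻¹ = 1 := Matrix.mul_nonsing_inv V hVdet
  have hc : V⁻¹ k k ≠ 0 := by
    have h1 := congrFun (congrFun hVVinv k) k
    rw [Matrix.mul_apply, Matrix.one_apply_eq, Finset.sum_eq_single k] at h1
    · exact right_ne_zero_of_mul_eq_one h1
    · intro m _ hm
      rcases lt_or_gt_of_ne hm with h | h
      · rw [hVupper k m h, zero_mul]
      · rw [hVinv m k h, mul_zero]
    · simp
  -- In these coordinates the kernel is `G` up to the permutation `π`. As `V⁻¹` is upper triangular,
  -- `U u i` depends only on `u_0, …, u_i`, so the past still determines `U u i` for `i < k`.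
  set U : (Fin ℓ → F) → Fin ℓ → F := fun u => Matrix.vecMul u V⁻¹ with hU
  have hUsum (u : Fin ℓ → F) (i : Fin ℓ) : U u i = ∑ m, u m * V⁻¹ m i := rfl
  have hgU (u : Fin ℓ → F) (m : Fin ℓ) : g u (π m) = ∑ i, U u i * G i m := by
    have h1 : g u = Matrix.vecMul (U u) (V * A) := by
      rw [hA, hU, Matrix.vecMul_vecMul, ← mul_assoc, Matrix.nonsing_inv_mul V hVdet, one_mul]
    rw [h1, hG]
    rfl
  have hgk (u : Fin ℓ → F) : g u (π k) = U u k := by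
    rw [hgU, Finset.sum_eq_single k, hkk, mul_one]
    · intro i _ hi
      rcases lt_or_gt_of_ne hi with h | h
      · rw [hGlower i k h, mul_zero]
      · rw [hrow i k h h.ne, mul_zero]
    · simp
  have hgj (u : Fin ℓ → F) :
      g u (π j) = ∑ i with i < k, U u i * G i j + G k j * U u k := by
    rw [hgU, ← Finset.sum_filter_add_sum_filter_not Finset.univ (fun i => i < k)]
    congr 1
    rw [Finset.sum_eq_single k]
    · ring
    · intro i hi hik
      have h : k < i := lt_of_le_of_ne (by simpa using hi) hik.symm
      rw [hrow i j h (hj.trans h).ne, mul_zero]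
    · simp
  have hpast (past : Set.Iio k → F) (x : F) (f : Set.Ioi k → F) (i : Fin ℓ) (hi : i < k) :
      U (glue k past x f) i = U (glue k past 0 0) i := by
    rw [hUsum, hUsum]
    refine Finset.sum_congr rfl fun m _ => ?_
    rcases le_or_gt m i with h | h
    · rw [glue_of_lt (h.trans_lt hi), glue_of_lt (h.trans_lt hi)]
    · rw [hVinv m i h, mul_zero, mul_zero]
  have hUk (past : Set.Iio k → F) (x : F) (f : Set.Ioi k → F) :
      U (glue k past x f) k = V⁻¹ k k * x + U (glue k past 0 0) k := by
    have h : U (glue k past x f) k - U (glue k past 0 0) k = V⁻¹ k k * x := by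
      rw [hUsum, hUsum, ← Finset.sum_sub_distrib, Finset.sum_eq_single k]
      · rw [glue_self, glue_self]
        ring
      · intro m _ hm
        rcases lt_or_gt_of_ne hm with h | h
        · rw [glue_of_lt h, glue_of_lt h, sub_self]
        · rw [hVinv m k h, mul_zero, mul_zero, sub_self]
      · simp
    linear_combination h
  refine ⟨V⁻¹ k k, hc, fun past => U (glue k past 0 0) k,
    fun past => ∑ i with i < k, U (glue k past 0 0) i * G i j, fun past x f => ?_,
    fun past x f => ?_⟩
  · rw [hgk, hUk]
  · rw [hgj, hgk]
    congr 1
    refine Finset.sum_congr rfl fun i hi => ?_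
    rw [hpast past x f i (by simpa using hi)]

theorem iterSubchannel_eq_iterState [Fintype F] (g : (Fin ℓ → F) → (Fin ℓ → F)) (W : DMC F)
    (b : ℕ → Fin ℓ) :
    ∀ n, iterSubchannel g W b n = iterState (fun W i => W.subchannel g i) W b n
  | 0 => rfl
  | n + 1 => by rw [iterSubchannel, iterState, iterSubchannel_eq_iterState g W b n]

end DMC

theorem mainTheorem2 {F : Type u} [Field F] [Fintype F] {ℓ : ℕ}
    -- the linear kernel, a linear bijection of `F^ℓ`, with its matrix `A` acting on row vectors
    (g : (Fin ℓ → F) ≃ₗ[F] (Fin ℓ → F))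
    (A : Matrix (Fin ℓ) (Fin ℓ) F) (hA : ∀ v, g v = Matrix.vecMul v A)
    -- a normal form `G` of the kernel: an invertible upper triangular matrix multiplies from the
    -- left and the columns are permuted (the case `V = 1`, `π = 1` is a kernel already normalized)
    (V : Matrix (Fin ℓ) (Fin ℓ) F) (hV : IsUnit V) (hVupper : ∀ i j, j < i → V i j = 0)
    (π : Equiv.Perm (Fin ℓ))
    (G : Matrix (Fin ℓ) (Fin ℓ) F) (hG : G = (V * A).submatrix id π)
    (hGlower : ∀ i j, i < j → G i j = 0) (hGdiag : ¬ G.IsDiag)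
    -- the last row with more than one non-zero entry
    (k : Fin ℓ) (hk : IsGreatest {i : Fin ℓ | 1 < {j : Fin ℓ | G i j ≠ 0}.ncard} k)
    (hkk : G k k = 1)
    -- an entry to the left of the diagonal that generates the multiplicative group of `F`
    (hprim : ∃ j : Fin ℓ, j < k ∧ IsPrimitiveRoot (G k j) (Fintype.card F - 1))
    (W : DMC F)
    {Ω : Type*} [MeasurableSpace Ω] (P : Measure Ω) [IsProbabilityMeasure P]
    (B : ℕ → Ω → Fin ℓ) (hBmeas : ∀ n, Measurable (B n)) (hBindep : iIndepFun B P)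
    (hBunif : ∀ n i, P.real {ω | B n ω = i} = 1 / (ℓ : ℝ)) :
    ∃ Iinf : Ω → ℝ, Measurable Iinf ∧
      (∀ᵐ ω ∂P, Tendsto
        (fun n => (DMC.iterSubchannel g W (fun m => B m ω) (n + 1)).symmetricCapacity)
        atTop (𝓝 (Iinf ω))) ∧
      P {ω | Iinf ω ∈ ({0, 1} : Set ℝ)} = 1 := by
  obtain ⟨j, hj, hprim⟩ := hprim
  obtain ⟨c, hc, L₁, L₂, h₁, h₂⟩ :=
    DMC.exists_shear_of_normal_form g hA hV hVupper π hG hGlower hk.2 hkk hj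
  obtain ⟨hmono, hgap⟩ := DMC.exists_symmetricCapacity_gap g.bijective
    (π.injective.ne hj.ne') hc h₁ h₂ hprim
  obtain ⟨L, hLm, hlim, hL⟩ := exists_limit_mem_zero_one hBmeas hBindep
    (fun n i => by rw [hBunif, Fintype.card_fin]) (step := fun W i => DMC.subchannel g W i) W
    (fun W => W.symmetricCapacity_nonneg) (fun W => W.symmetricCapacity_le_one)
    (fun W => by rw [Fintype.card_fin]; exact W.sum_symmetricCapacity_subchannel g g.bijective)
    hmono hgap
  refine ⟨L, hLm, ?_, ?_⟩
  · simpa only [DMC.iterSubchannel_eq_iterState] using hlim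
  · exact (mem_ae_iff_prob_eq_one (hLm (Set.toFinite {0, 1}).measurableSet)).1 hL
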